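/- Let $M$ be a finite-dimensional smooth manifold and let $\omega\in\Omega^4(M)$ be a 3-plectic form, i.e. $d\omega=0$ and, for every $x\in M$ and $v\in T_xM$, $\iota(v)\omega_x=0$ implies $v=0$. A 2-form $\alpha$ is called Hamiltonian if there is a (then unique) smooth vector field $v_\alpha$ with $d\alpha=-\iota(v_\alpha)\omega$; for forms $\alpha$ of degree $0$ or $1$ put $v_\alpha=0$. Let $L$ be the three-term chain complex $$\Omega^2_{\mathrm{Ham}}(M)\xleftarrow{\ d\ }\Omega^1(M)\xleftarrow{\ d\ }\Omega^0(M)=C^\infty(M)$$ in degrees $0,1,2$, with the de Rham differential. Write $\iota(v_1,\dots,v_k)=\iota(v_k)\cdots\iota(v_1)$ and $\mathcal L(v)$ for the Lie derivative; a contraction of a $0$-form, or a value lying outside the degrees $0,1,2$, is $0$. Recall the following notions; all maps are graded multilinear, $\partial(f)=d\circ f-(-1)^{|f|}f\circ d$, $f\circ_i g$ is the insertion of $g$ in the $i$-th slot of $f$, $f^\sigma(x_1,\dots,x_n)=\pm f(x_{\sigma^{-1}(1)},\dots,x_{\sigma^{-1}(n)})$, and Koszul signs are used throughout. A weak Lie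 3-algebra is a three-term complex $L_0\leftarrow L_1\leftarrow L_2$ with maps $\lambda_2$ (degree $0$, arity $2$), $\lambda_{2;1}$ (degree $1$, arity $2$), $\lambda_{2;1,1}$ (degree $2$, arity $2$), $\lambda_3$ (degree $1$, arity $3$), $\lambda_{3;1},\lambda_{3;2}$ (degree $2$, arity $3$), $\lambda_4$ (degree $2$, arity $4$) such that $(\lambda_2,\lambda_3,\lambda_4)$ is a homotopy Leibniz algebra structure, i.e. $$\partial(\lambda_2) = 0,$$ $$\partial(\lambda_3) = \lambda_2\circ_2\lambda_2 - \lambda_2\circ_1\lambda_2 - (\lambda_2\circ_2\lambda_2)^{(12)},$$ $$\partial(\lambda_4) = \lambda_2\circ_1\lambda_3 + \lambda_2\circ_2\lambda_3 - (\lambda_2\circ_2\lambda_3)^{(12)} + (\lambda_2\circ_2\lambda_3)^{(123)} - \lambda_3\circ_1\lambda_2 + \lambda_3\circ_2\lambda_2 - (\lambda_3\circ_2\lambda_2)^{(12)} - \lambda_3\circ_3\lambda_2 + (\lambda_3\circ_3\lambda_2)^{(23)} - (\lambda_3\circ_3\lambda_2)^{(132)},$$ $$0 = \lambda_2\circ_1\lambda_4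 - \lambda_2\circ_2\lambda_4 + (\lambda_2\circ_2\lambda_4)^{(12)} - (\lambda_2\circ_2\lambda_4)^{(123)} + (\lambda_2\circ_2\lambda_4)^{(1234)} + \lambda_3\circ_1\lambda_3 + \lambda_3\circ_2\lambda_3 - (\lambda_3\circ_2\lambda_3)^{(12)} + (\lambda_3\circ_2\lambda_3)^{(123)} + \lambda_3\circ_3\lambda_3 - (\lambda_3\circ_3\lambda_3)^{(23)} + (\lambda_3\circ_3\lambda_3)^{(132)} + (\lambda_3\circ_3\lambda_3)^{(234)} - (\lambda_3\circ_3\lambda_3)^{(1342)} + (\lambda_3\circ_3\lambda_3)^{(13)(24)} + \lambda_4\circ_1\lambda_2 - \lambda_4\circ_2\lambda_2 + (\lambda_4\circ_2\lambda_2)^{(12)} + \lambda_4\circ_3\lambda_2 - (\lambda_4\circ_3\lambda_2)^{(23)} + (\lambda_4\circ_3\lambda_2)^{(132)} - \lambda_4\circ_4\lambda_2 + (\lambda_4\circ_4\lambda_2)^{(34)} - (\lambda_4\circ_4\lambda_2)^{(243)} + (\lambda_4\circ_4\lambda_2)^{(1432)},$$ and $$\partial\lambda_{2;1}=\lambda_2+\lambda_2^{(12)},\quad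 \partial\lambda_{2;1,1}=\lambda_{2;1}-\lambda_{2;1}^{(12)},\quad \lambda_{2;1,1}+\lambda_{2;1,1}^{(12)}=0,$$ $$\partial\lambda_{3;1}=\lambda_3+\lambda_3^{(12)}+\lambda_2\circ_1\lambda_{2;1},\qquad \lambda_{3;1}-\lambda_{3;1}^{(12)}=\lambda_2\circ_1\lambda_{2;1,1},$$ $$\partial\lambda_{3;2}=\lambda_3+\lambda_3^{(23)}-\lambda_2\circ_2\lambda_{2;1}+\lambda_{2;1}\circ_1\lambda_2+(\lambda_{2;1}\circ_2\lambda_2)^{(12)},$$ $$\lambda_{3;2}-\lambda_{3;2}^{(23)}=-\lambda_2\circ_2\lambda_{2;1,1}+\lambda_{2;1,1}\circ_1\lambda_2+(\lambda_{2;1,1}\circ_2\lambda_2)^{(12)},$$ $$\lambda_{3;1}-\lambda_{3;2}^{(12)}+\lambda_{3;1}^{(132)}-\lambda_{3;2}+\lambda_{3;1}^{(23)}-\lambda_{3;2}^{(123)}=\lambda_{2;1}\circ_2\lambda_{2;1}+\lambda_{2;1}\circ_1\lambda_{2;1}+(\lambda_{2;1}\circ_2\lambda_{2;1})^{(12)}+(\lambda_{2;1,1}\circ_2\lambda_2)^{(132)},$$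 $$\lambda_4+\lambda_4^{(12)}=\lambda_2\circ_1\lambda_{3;1}-\lambda_{3;1}\circ_3\lambda_2+(\lambda_2\circ_2\lambda_{3;1})^{(123)}+\lambda_3\circ_1\lambda_{2;1},$$ $$\lambda_4+\lambda_4^{(23)}=\lambda_2\circ_1\lambda_{3;2}-\lambda_3\circ_2\lambda_{2;1}+\lambda_2\circ_2\lambda_{3;1}-\lambda_{3;1}\circ_1\lambda_2-(\lambda_{3;1}\circ_2\lambda_2)^{(12)}-(\lambda_{3;1}\circ_3\lambda_2)^{(132)},$$ $$\begin{aligned}\lambda_4+\lambda_4^{(34)}={}&\lambda_{2;1}\circ_1\lambda_3-\lambda_{3;2}\circ_1\lambda_2+\lambda_{3;2}\circ_2\lambda_2-(\lambda_{3;2}\circ_2\lambda_2)^{(12)}+\lambda_3\circ_3\lambda_{2;1}+(\lambda_{3;2}\circ_3\lambda_2)^{(23)}\\&-(\lambda_{3;2}\circ_3\lambda_2)^{(132)}+\lambda_2\circ_2\lambda_{3;2}-(\lambda_2\circ_2\lambda_{3;2})^{(12)}+(\lambda_{2;1}\circ_2\lambda_3)^{(123)}.\end{aligned}$$ A weak morphism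 $(L,\lambda)\to(L',\lambda')$ consists of maps $f_1$ (degree $0$, arity $1$), $f_2$ (degree $1$, arity $2$), $f_{2;1}$ (degree $2$, arity $2$), $f_3$ (degree $2$, arity $3$) such that $(f_1,f_2,f_3)$ is a homotopy morphism of homotopy Leibniz algebras, i.e. $$\partial(f_1) = 0,$$ $$\partial(f_2) = f_1\circ\lambda_2 - \lambda'_2\circ(f_1,f_1),$$ $$\partial(f_3) = f_1\circ\lambda_3 - f_2\circ_2\lambda_2 + f_2\circ_1\lambda_2 + (f_2\circ_2\lambda_2)^{(12)} - \lambda'_3\circ(f_1,f_1,f_1) - \lambda'_2\circ(f_1,f_2) + \lambda'_2\circ(f_2,f_1) + \lambda'_2\circ(f_1,f_2)^{(12)},$$ $$f_1\circ\lambda_4 - \lambda'_4\circ(f_1,f_1,f_1,f_1) = f_2\circ_1\lambda_3 + f_2\circ_2\lambda_3 - (f_2\circ_2\lambda_3)^{(12)} + (f_2\circ_2\lambda_3)^{(123)} - f_3\circ_1\lambda_2 + f_3\circ_2\lambda_2 - (f_3\circ_2\lambda_2)^{(12)} - f_3\circ_3\lambda_2 + (f_3\circ_3\lambda_2)^{(23)}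 - (f_3\circ_3\lambda_2)^{(132)} + \lambda'_2\circ(f_3,f_1) + \lambda'_2\circ(f_1,f_3) - \lambda'_2\circ(f_1,f_3)^{(12)} + \lambda'_2\circ(f_1,f_3)^{(123)} - \lambda'_2\circ(f_2,f_2) + \lambda'_2\circ(f_2,f_2)^{(23)} - \lambda'_2\circ(f_2,f_2)^{(132)} + \lambda'_3\circ(f_2,f_1,f_1) - \lambda'_3\circ(f_1,f_2,f_1) + \lambda'_3\circ(f_1,f_2,f_1)^{(12)} + \lambda'_3\circ(f_1,f_1,f_2) - \lambda'_3\circ(f_1,f_1,f_2)^{(23)} + \lambda'_3\circ(f_1,f_1,f_2)^{(132)},$$ and $$\partial f_{2;1}=-f_2-f_2^{(12)}+f_1\circ\lambda_{2;1}-\lambda'_{2;1}\circ(f_1,f_1),\qquad f_1\circ\lambda_{2;1,1}-\lambda'_{2;1,1}\circ(f_1,f_1)=f_{2;1}-f_{2;1}^{(12)},$$ $$f_1\circ\lambda_{3;1}-\lambda'_{3;1}\circ(f_1,f_1,f_1)=f_3+f_3^{(12)}+f_2\circ_1\lambda_{2;1}+\lambda'_2\circ(f_{2;1},f_1),$$ $$\begin{aligned}f_1\circ\lambda_{3;2}-\lambda'_{3;2}\circ(f_1,f_1,f_1)={}&f_3+f_3^{(23)}-f_2\circ_2\lambda_{2;1}+f_{2;1}\circ_1\lambda_2+(f_{2;1}\circ_2\lambda_2)^{(12)}\\&-\lambda'_2\circ(f_1,f_{2;1})-\lambda'_{2;1}\circ(f_2,f_1)-\lambda'_{2;1}\circ(f_1,f_2)^{(12)}.\end{aligned}$$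 The composition has components $(g\circ f)_1=g_1\circ f_1$, $(g\circ f)_2=g_2\circ(f_1,f_1)+g_1\circ f_2$, $(g\circ f)_{2;1}=g_{2;1}\circ(f_1,f_1)+g_1\circ f_{2;1}$ and $(g\circ f)_3=g_3\circ(f_1,f_1,f_1)-g_2\circ(f_2,f_1)+g_2\circ(f_1,f_2)-g_2\circ(f_1,f_2)^{(12)}+g_1\circ f_3$; the identity has $f_1=\mathrm{id}$ and all other components $0$. Then: (1) The maps $\lambda_2(\alpha,\beta)=\iota(v_\alpha,v_\beta)\omega$, $\lambda_3(\alpha,\beta,\gamma)=-\iota(v_\alpha,v_\beta,v_\gamma)\omega$, $\lambda_4(\alpha,\beta,\gamma,\eta)=-\iota(v_\alpha,v_\beta,v_\gamma,v_\eta)\omega$ and $\lambda_{2;1}=\lambda_{2;1,1}=\lambda_{3;1}=\lambda_{3;2}=0$ form a weak Lie 3-algebra structure on $L$, denoted $L_\infty(M,\omega)$. (2) The maps $\lambda'_2(\alpha,\beta)=\mathcal L(v_\alpha)\beta$, $\lambda'_{2;1}(\alpha,\beta)=\iota(v_\alpha)\beta+\iota(v_\beta)\alpha$ and $\lambda'_{2;1,1}=\lambda'_3=\lambda'_{3;1}=\lambda'_{3;2}=\lambda'_4=0$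 form a weak Lie 3-algebra structure on $L$, denoted $\mathrm{Leib}(M,\omega)$. (For instance, $\lambda'_{2;1}(\alpha,\beta)$ is a 1-form for $\alpha,\beta\in\Omega^2_{\mathrm{Ham}}(M)$ and a function if one of the two is a 1-form.) (3) $f_1=\mathrm{id}$, $f_2(\alpha,\beta)=-\iota(v_\alpha)\beta$, $f_{2;1}=0$, $f_3(\alpha,\beta,\gamma)=-\iota(v_\alpha,v_\beta)\gamma$ define a weak morphism $f\colon L_\infty(M,\omega)\to\mathrm{Leib}(M,\omega)$ of weak Lie 3-algebras, and $f$ is an isomorphism: there is a weak morphism $g\colon\mathrm{Leib}(M,\omega)\to L_\infty(M,\omega)$ with $g\circ f=\mathrm{id}$ and $f\circ g=\mathrm{id}$. -/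

import Mathlib

noncomputable section

namespace ThreePlectic

universe u v

/-! ## Graded multilinear maps on three-term complexes -/

/-- A three-term chain complex `L₀ ← L₁ ← L₂` of `R`-modules. -/
structure ThreeTermComplex (R : Type u) [CommRing R] where
  L0 : Type v
  L1 : Type v
  L2 : Type v
  [addCommGroup0 : AddCommGroup L0]
  [addCommGroup1 : AddCommGroup L1]
  [addCommGroup2 : AddCommGroup L2]
  [module0 : Module R L0]
  [module1 : Module R L1]
  [module2 : Module R L2]
  d1 : L1 →ₗ[R] L0
  d2 : L2 →ₗ[R] L1
  d1_comp_d2 : d1 ∘ₗ d2 = 0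

namespace ThreeTermComplex

attribute [instance] addCommGroup0 addCommGroup1 addCommGroup2 module0 module1 module2

variable {R : Type u} [CommRing R]

/-- The total module `L₀ ⊕ L₁ ⊕ L₂`. -/
abbrev Tot (C : ThreeTermComplex.{u, v} R) : Type v := C.L0 × C.L1 × C.L2

/-- The differential on the total module. -/
def d (C : ThreeTermComplex.{u, v} R) : C.Tot →ₗ[R] C.Tot where
  toFun x := (C.d1 x.2.1, C.d2 x.2.2, 0)
  map_add' x y := by simp
  map_smul' c x := by simp

/-- The homogeneous elements of degree `i` of the total module (only `0` unless `i = 0, 1, 2`). -/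
def gr (C : ThreeTermComplex.{u, v} R) (i : ℤ) : Submodule R C.Tot where
  carrier := {x | (i ≠ 0 → x.1 = 0) ∧ (i ≠ 1 → x.2.1 = 0) ∧ (i ≠ 2 → x.2.2 = 0)}
  add_mem' := by
    rintro x y ⟨hx0, hx1, hx2⟩ ⟨hy0, hy1, hy2⟩
    exact ⟨fun h => by simp [hx0 h, hy0 h], fun h => by simp [hx1 h, hy1 h],
      fun h => by simp [hx2 h, hy2 h]⟩
  zero_mem' := by simp
  smul_mem' := by
    rintro c x ⟨hx0, hx1, hx2⟩
    exact ⟨fun h => by simp [hx0 h], fun h => by simp [hx1 h], fun h => by simp [hx2 h]⟩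

end ThreeTermComplex

section Operations

variable {R : Type u} [CommRing R]

/-- A multilinear map `L^{⊗n} → L'` that is homogeneous of degree `p`. -/
structure GMap (C D : ThreeTermComplex.{u, v} R) (p : ℤ) (n : ℕ) where
  toMap : MultilinearMap R (fun _ : Fin n => C.Tot) D.Tot
  mem_gr : ∀ (e : Fin n → ℤ) (x : Fin n → C.Tot), (∀ i, x i ∈ C.gr (e i)) →
    toMap x ∈ D.gr (p + ∑ i, e i)

/-- An operation of degree `p` and arity `n`, recorded through its values on tuples of
homogeneous elements. An argument is a pair of a degree and an element, and only the values where
every element has the degree that it is paired with are ever used, see `Op.Eq`. -/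
abbrev Op (C D : ThreeTermComplex.{u, v} R) (_p : ℤ) (n : ℕ) : Type v :=
  (Fin n → ℤ × C.Tot) → D.Tot

variable {C D F : ThreeTermComplex.{u, v} R} {p q r s : ℤ} {n m k l : ℕ}

/-- Two operations agree on all tuples of homogeneous elements. -/
def Op.Eq (f g : Op C D p n) : Prop :=
  ∀ x : Fin n → ℤ × C.Tot, (∀ i, (x i).2 ∈ C.gr (x i).1) → f x = g x

notation:50 f " ≐ " g:51 => Op.Eq f g

/-- The operation given by a graded multilinear map. -/
def GMap.op (f : GMap C D p n) : Op C D p n := fun x => f.toMap fun i => (x i).2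

/-- The value of `f` on a tuple of homogeneous elements, paired with its degree. -/
def GMap.val (f : GMap C D p n) (x : Fin n → ℤ × C.Tot) : ℤ × D.Tot :=
  (p + ∑ i, (x i).1, f.op x)

/-- The differential `∂ f = d ∘ f - (-1)^|f| f ∘ d` of the complex of multilinear maps, where `d`
acts on tensors by the Leibniz rule with Koszul signs. -/
def GMap.bd (f : GMap C D p n) : Op C D (p - 1) n := fun x =>
  D.d (f.op x) - p.negOnePow • ∑ i, (∑ j ∈ Finset.univ.filter (· < i), (x j).1).negOnePow •
    f.op (Function.update x i ((x i).1 - 1, C.d (x i).2))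

/-- The partial composition of `f` with `g` inserted in the slot `i` (counted from `0`), with the
Koszul sign for moving `g` past the arguments to its left. -/
def GMap.circ (f : GMap C D p (m + 1)) (i : Fin (m + 1)) (g : GMap C C q n) :
    Op C D (p + q) (m + n) := fun x =>
  (q * ∑ j : Fin i, (x ⟨j, by omega⟩).1).negOnePow • f.op fun j =>
    if h : j < i then x ⟨j, by omega⟩
    else if h' : j = i then g.val fun t : Fin n => x ⟨i + t, by omega⟩
    else x ⟨j + n - 1, by omega⟩

/-- `h ∘ (g, …, g)` for `g` unary of degree `0`. -/
def GMap.compDiag (h : GMap D F p n) (g : GMap C D 0 1) : Op C F p n := fun x =>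
  h.op fun i => g.val ![x i]

/-- The composition `h ∘ g` with `h` unary. -/
def GMap.comp1 (h : GMap D F p 1) (g : GMap C D q n) : Op C F (p + q) n := fun x =>
  h.op ![g.val x]

/-- The composition `h ∘ (g₁, g₂)`, with Koszul signs. -/
def GMap.comp2 (h : GMap D F p 2) (g₁ : GMap C D q m) (g₂ : GMap C D r n) :
    Op C F (p + q + r) (m + n) := fun x =>
  (r * ∑ i : Fin m, (x (i.castAdd n)).1).negOnePow •
    h.op ![g₁.val fun i => x (i.castAdd n), g₂.val fun i => x (i.natAdd m)]

/-- The composition `h ∘ (g₁, g₂, g₃)`, with Koszul signs. -/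
def GMap.comp3 (h : GMap D F p 3) (g₁ : GMap C D q m) (g₂ : GMap C D r n) (g₃ : GMap C D s k) :
    Op C F (p + q + r + s) (m + n + k) := fun x =>
  (r * ∑ i : Fin m, (x ((i.castAdd n).castAdd k)).1 +
      s * ∑ i : Fin (m + n), (x (i.castAdd k)).1).negOnePow •
    h.op ![g₁.val fun i => x ((i.castAdd n).castAdd k), g₂.val fun i => x ((i.natAdd m).castAdd k),
      g₃.val fun i => x (i.natAdd (m + n))]

/-- The Koszul sign of moving the `i`-th of `n` homogeneous elements of degrees `e` to the
position `σ i`, for all `i`. -/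
def koszulSign (σ : Equiv.Perm (Fin n)) (e : Fin n → ℤ) : ℤˣ :=
  ∏ i, ∏ j, if i < j ∧ σ j < σ i then (e i * e j).negOnePow else 1

/-- The right action of permutations on operations:
`f^σ (x₁, …, xₙ) = ± f (x_{σ⁻¹(1)}, …, x_{σ⁻¹(n)})` with the Koszul sign. -/
def Op.act (f : Op C D p n) (σ : Equiv.Perm (Fin n)) : Op C D p n := fun x =>
  koszulSign σ (fun i => (x i).1) • f fun i => x (σ⁻¹ i)

/-- The cyclic permutation `a₁ ↦ a₂ ↦ ⋯ ↦ aₖ ↦ a₁` (as usual, but with entries counted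
from `0`). -/
def cyc (a : List (Fin n)) : Equiv.Perm (Fin n) := a.formPerm

end Operations

/-! ## Weak Lie 3-algebras -/

section WeakLie

variable {R : Type u} [CommRing R]

/-- A weak Lie 3-algebra structure on a three-term complex. -/
structure WeakLie3Algebra (C : ThreeTermComplex.{u, v} R) where
  l2 : GMap C C 0 2
  l21 : GMap C C 1 2
  l211 : GMap C C 2 2
  l3 : GMap C C 1 3
  l31 : GMap C C 2 3
  l32 : GMap C C 2 3
  l4 : GMap C C 2 4
  -- the underlying Leibniz 3-algebra
  leib2 : l2.bd ≐ 0
  leib3 : l3.bd ≐ l2.circ 1 l2 - l2.circ 0 l2 - (l2.circ 1 l2).act (cyc [0, 1])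
  leib4 : l4.bd ≐
    l2.circ 0 l3 + l2.circ 1 l3 - (l2.circ 1 l3).act (cyc [0, 1])
    + (l2.circ 1 l3).act (cyc [0, 1, 2]) - l3.circ 0 l2
    + l3.circ 1 l2 - (l3.circ 1 l2).act (cyc [0, 1])
    - l3.circ 2 l2 + (l3.circ 2 l2).act (cyc [1, 2])
    - (l3.circ 2 l2).act (cyc [0, 2, 1])
  leib5 : 0 ≐
    l2.circ 0 l4 - l2.circ 1 l4
    + (l2.circ 1 l4).act (cyc [0, 1])
    - (l2.circ 1 l4).act (cyc [0, 1, 2]) + (l2.circ 1 l4).act (cyc [0, 1, 2, 3])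
    + l3.circ 0 l3 + l3.circ 1 l3
    - (l3.circ 1 l3).act (cyc [0, 1])
    + (l3.circ 1 l3).act (cyc [0, 1, 2]) + l3.circ 2 l3
    - (l3.circ 2 l3).act (cyc [1, 2]) + (l3.circ 2 l3).act (cyc [0, 2, 1])
    + (l3.circ 2 l3).act (cyc [1, 2, 3]) - (l3.circ 2 l3).act (cyc [0, 2, 3, 1])
    + (l3.circ 2 l3).act (cyc [0, 2] * cyc [1, 3])
    + l4.circ 0 l2 - l4.circ 1 l2
    + (l4.circ 1 l2).act (cyc [0, 1])
    + l4.circ 2 l2 - (l4.circ 2 l2).act (cyc [1, 2])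
    + (l4.circ 2 l2).act (cyc [0, 2, 1]) - l4.circ 3 l2
    + (l4.circ 3 l2).act (cyc [2, 3]) - (l4.circ 3 l2).act (cyc [1, 3, 2])
    + (l4.circ 3 l2).act (cyc [0, 3, 2, 1])
  -- the symmetry up to homotopy
  bd_l21 : l21.bd ≐ l2.op + l2.op.act (cyc [0, 1])
  bd_l211 : l211.bd ≐ l21.op - l21.op.act (cyc [0, 1])
  bd_l31 : l31.bd ≐ l3.op + l3.op.act (cyc [0, 1]) + l2.circ 0 l21
  bd_l32 : l32.bd ≐
    l3.op + l3.op.act (cyc [1, 2]) - l2.circ 1 l21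
    + l21.circ 0 l2 + (l21.circ 1 l2).act (cyc [0, 1])
  sym_l211 : l211.op + l211.op.act (cyc [0, 1]) ≐ 0
  sym_l31 : l31.op - l31.op.act (cyc [0, 1]) ≐ l2.circ 0 l211
  sym_l31_l32 :
    l31.op - l32.op.act (cyc [0, 1]) + l31.op.act (cyc [0, 2, 1])
    - l32.op + l31.op.act (cyc [1, 2]) - l32.op.act (cyc [0, 1, 2]) ≐
    l21.circ 1 l21 + l21.circ 0 l21
    + (l21.circ 1 l21).act (cyc [0, 1]) + (l211.circ 1 l2).act (cyc [0, 2, 1])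
  sym_l32 : l32.op - l32.op.act (cyc [1, 2]) ≐
    - l2.circ 1 l211 + l211.circ 0 l2 + (l211.circ 1 l2).act (cyc [0, 1])
  sym_l4_12 : l4.op + l4.op.act (cyc [0, 1]) ≐
    l2.circ 0 l31 - l31.circ 2 l2
    + (l2.circ 1 l31).act (cyc [0, 1, 2]) + l3.circ 0 l21
  sym_l4_23 : l4.op + l4.op.act (cyc [1, 2]) ≐
    l2.circ 0 l32 - l3.circ 1 l21 + l2.circ 1 l31
    - l31.circ 0 l2 - (l31.circ 1 l2).act (cyc [0, 1])
    - (l31.circ 2 l2).act (cyc [0, 2, 1])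
  sym_l4_34 : l4.op + l4.op.act (cyc [2, 3]) ≐
    l21.circ 0 l3 - l32.circ 0 l2
    + l32.circ 1 l2 - (l32.circ 1 l2).act (cyc [0, 1])
    + l3.circ 2 l21
    + (l32.circ 2 l2).act (cyc [1, 2]) - (l32.circ 2 l2).act (cyc [0, 2, 1])
    + l2.circ 1 l32 - (l2.circ 1 l32).act (cyc [0, 1])
    + (l21.circ 1 l3).act (cyc [0, 1, 2])

variable {C D : ThreeTermComplex.{u, v} R}

/-- A weak morphism of weak Lie 3-algebras. -/
structure WeakMorphism (A : WeakLie3Algebra C) (B : WeakLie3Algebra D) where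
  f1 : GMap C D 0 1
  f2 : GMap C D 1 2
  f21 : GMap C D 2 2
  f3 : GMap C D 2 3
  -- the underlying weak morphism of Leibniz 3-algebras
  leib1 : f1.bd ≐ 0
  leib2 : f2.bd ≐ f1.comp1 A.l2 - B.l2.compDiag f1
  leib3 : f3.bd ≐
    f1.comp1 A.l3
    - f2.circ 1 A.l2 + f2.circ 0 A.l2 + (f2.circ 1 A.l2).act (cyc [0, 1])
    - B.l3.compDiag f1
    - B.l2.comp2 f1 f2 + B.l2.comp2 f2 f1 + (B.l2.comp2 f1 f2).act (cyc [0, 1])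
  leib4 : f1.comp1 A.l4 - B.l4.compDiag f1 ≐
    f2.circ 0 A.l3 + f2.circ 1 A.l3 - (f2.circ 1 A.l3).act (cyc [0, 1])
    + (f2.circ 1 A.l3).act (cyc [0, 1, 2]) - f3.circ 0 A.l2
    + f3.circ 1 A.l2 - (f3.circ 1 A.l2).act (cyc [0, 1]) - f3.circ 2 A.l2
    + (f3.circ 2 A.l2).act (cyc [1, 2]) - (f3.circ 2 A.l2).act (cyc [0, 2, 1])
    + B.l2.comp2 f3 f1 + B.l2.comp2 f1 f3 - (B.l2.comp2 f1 f3).act (cyc [0, 1])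
    + (B.l2.comp2 f1 f3).act (cyc [0, 1, 2])
    - B.l2.comp2 f2 f2 + (B.l2.comp2 f2 f2).act (cyc [1, 2])
    - (B.l2.comp2 f2 f2).act (cyc [0, 2, 1])
    + B.l3.comp3 f2 f1 f1
    - B.l3.comp3 f1 f2 f1 + (B.l3.comp3 f1 f2 f1).act (cyc [0, 1])
    + B.l3.comp3 f1 f1 f2
    - (B.l3.comp3 f1 f1 f2).act (cyc [1, 2]) + (B.l3.comp3 f1 f1 f2).act (cyc [0, 2, 1])
  -- the compatibility with the symmetry up to homotopy
  bd_f21 : f21.bd ≐ - f2.op - f2.op.act (cyc [0, 1]) + f1.comp1 A.l21 - B.l21.compDiag f1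
  sym_l211 : f1.comp1 A.l211 - B.l211.compDiag f1 ≐ f21.op - f21.op.act (cyc [0, 1])
  sym_l31 : f1.comp1 A.l31 - B.l31.compDiag f1 ≐
    f3.op + f3.op.act (cyc [0, 1]) + f2.circ 0 A.l21 + B.l2.comp2 f21 f1
  sym_l32 : f1.comp1 A.l32 - B.l32.compDiag f1 ≐
    f3.op + f3.op.act (cyc [1, 2]) - f2.circ 1 A.l21
    + f21.circ 0 A.l2 + (f21.circ 1 A.l2).act (cyc [0, 1])
    - B.l2.comp2 f1 f21 - B.l21.comp2 f2 f1
    - (B.l21.comp2 f1 f2).act (cyc [0, 1])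

/-- The composition `g ∘ f` of weak morphisms is the identity, that is, its components are
`(g ∘ f)₁ = id` and `(g ∘ f)₂ = 0`, `(g ∘ f)_{2;1} = 0`, `(g ∘ f)₃ = 0`. -/
structure WeakMorphism.CompEqId {A : WeakLie3Algebra C} {B : WeakLie3Algebra D}
    (g : WeakMorphism B A) (f : WeakMorphism A B) : Prop where
  comp1 : g.f1.compDiag f.f1 ≐ fun x => (x 0).2
  comp2 : g.f2.compDiag f.f1 + g.f1.comp1 f.f2 ≐ 0
  comp21 : g.f21.compDiag f.f1 + g.f1.comp1 f.f21 ≐ 0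
  comp3 : g.f3.compDiag f.f1 - g.f2.comp2 f.f2 f.f1 + g.f2.comp2 f.f1 f.f2
    - (g.f2.comp2 f.f1 f.f2).act (cyc [0, 1]) + g.f1.comp1 f.f3 ≐ 0

/-- A weak morphism is an isomorphism if it has a two-sided inverse weak morphism. -/
def WeakMorphism.IsIso {A : WeakLie3Algebra C} {B : WeakLie3Algebra D}
    (f : WeakMorphism A B) : Prop :=
  ∃ g : WeakMorphism B A, g.CompEqId f ∧ f.CompEqId g

end WeakLie

/-! ## Differential forms on manifolds -/

section Geometry

open scoped Manifold ContDiff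

variable {E : Type u} [NormedAddCommGroup E] [NormedSpace ℝ E]
  {M : Type v} [TopologicalSpace M] [ChartedSpace E M]

/-- Not necessarily smooth differential `k`-forms on `M`. -/
abbrev PreForm (E : Type u) [NormedAddCommGroup E] [NormedSpace ℝ E] (M : Type v)
    [TopologicalSpace M] [ChartedSpace E M] (k : ℕ) : Type (max u v) :=
  ∀ x : M, TangentSpace 𝓘(ℝ, E) x [⋀^Fin k]→L[ℝ] ℝ

/-- The pullback of a form along the inverse of the preferred chart at `a`; only its values on the
target of the chart matter. -/
def localForm {k : ℕ} (a : M) (α : PreForm E M k) (y : E) : E [⋀^Fin k]→L[ℝ] ℝ :=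
  (α ((extChartAt 𝓘(ℝ, E) a).symm y)).compContinuousLinearMap
    (mfderiv 𝓘(ℝ, E) 𝓘(ℝ, E) (extChartAt 𝓘(ℝ, E) a).symm y)

/-- The exterior derivative, computed at each point in the preferred chart there. -/
def extD {k : ℕ} (α : PreForm E M k) : PreForm E M (k + 1) := fun x =>
  (extDeriv (localForm x α) (extChartAt 𝓘(ℝ, E) x x)).compContinuousLinearMap
    (mfderiv 𝓘(ℝ, E) 𝓘(ℝ, E) (extChartAt 𝓘(ℝ, E) x) x)

/-- A form is smooth if its expressions in the charts are. -/
def IsSmooth {k : ℕ} (α : PreForm E M k) : Prop :=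
  ∀ a : M, ContDiffOn ℝ ∞ (localForm a α) (extChartAt 𝓘(ℝ, E) a).target

theorem two_le : minSmoothness ℝ 2 ≤ ∞ := by
  rw [minSmoothness_of_isRCLikeNormedField]
  exact WithTop.coe_le_coe.2 (le_top : (2 : ℕ∞) ≤ ⊤)

theorem localForm_add {k : ℕ} (a : M) (α β : PreForm E M k) :
    localForm a (α + β) = localForm a α + localForm a β := rfl

theorem localForm_smul {k : ℕ} (a : M) (c : ℝ) (α : PreForm E M k) :
    localForm a (c • α) = c • localForm a α := rfl

theorem localForm_contDiffAt {k : ℕ} {α : PreForm E M k} (hα : IsSmooth α) (a : M) {y : E}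
    (hy : y ∈ (extChartAt 𝓘(ℝ, E) a).target) : ContDiffAt ℝ ∞ (localForm a α) y :=
  (hα a).contDiffAt ((isOpen_extChartAt_target a).mem_nhds hy)

theorem extD_smul {k : ℕ} (c : ℝ) (α : PreForm E M k) : extD (c • α) = c • extD α := by
  funext x
  have h : extDeriv (localForm x (c • α)) (extChartAt 𝓘(ℝ, E) x x) = _ :=
    extDeriv_smul c (localForm x α)
  change ContinuousAlternatingMap.compContinuousLinearMap _ _ = _
  rw [h]
  rfl

theorem extD_add {k : ℕ} {α β : PreForm E M k} (hα : IsSmooth α) (hβ : IsSmooth β) :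
    extD (α + β) = extD α + extD β := by
  funext x
  have hx := mem_extChartAt_target (I := 𝓘(ℝ, E)) x
  have h : extDeriv (localForm x (α + β)) (extChartAt 𝓘(ℝ, E) x x) = _ :=
    extDeriv_add ((localForm_contDiffAt hα x hx).differentiableAt (by simp))
      ((localForm_contDiffAt hβ x hx).differentiableAt (by simp))
  change ContinuousAlternatingMap.compContinuousLinearMap _ _ = _
  rw [h]
  rfl


theorem isSmooth_zero {k : ℕ} : IsSmooth (0 : PreForm E M k) := fun _ =>
  contDiffOn_const (c := (0 : E [⋀^Fin k]→L[ℝ] ℝ))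

variable (E M) in
/-- The smooth differential `k`-forms, as a submodule. -/
def smoothForms (k : ℕ) : Submodule ℝ (PreForm E M k) where
  carrier := {α | IsSmooth α}
  add_mem' hα hβ a := (hα a).add (hβ a)
  zero_mem' := isSmooth_zero
  smul_mem' c _ hα a := (hα a).const_smul c

variable (E M) in
/-- The space `Ω^k(M)` of smooth differential `k`-forms. -/
def Form (k : ℕ) : Type (max u v) := smoothForms E M k

instance (k : ℕ) : AddCommGroup (Form E M k) := Submodule.addCommGroup _

instance (k : ℕ) : Module ℝ (Form E M k) := Submodule.module _

/-- The contraction `ι(v)α = α(v, ⋅, …, ⋅)`. -/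
def contract {k : ℕ} (v : ∀ x : M, TangentSpace 𝓘(ℝ, E) x) (α : PreForm E M (k + 1)) :
    PreForm E M k := fun x =>
  ContinuousAlternatingMap.curryLeft (E := E) (α x) (v x)

/-- The expression of a vector field in the preferred chart at `a`. -/
def localField (a : M) (v : ∀ x : M, TangentSpace 𝓘(ℝ, E) x) (y : E) : E :=
  mfderiv 𝓘(ℝ, E) 𝓘(ℝ, E) (extChartAt 𝓘(ℝ, E) a) ((extChartAt 𝓘(ℝ, E) a).symm y)
    (v ((extChartAt 𝓘(ℝ, E) a).symm y))

/-- The Lie derivative of a form along a vector field, evaluated at `x` on tangent vectors `u`.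
In a chart it is `∑ⱼ vʲ ∂ⱼ α (u₁, …, uₖ) + ∑ᵢ α (u₁, …, Dv(uᵢ), …, uₖ)`. -/
def lieDeriv {k : ℕ} (v : ∀ x : M, TangentSpace 𝓘(ℝ, E) x) (α : PreForm E M k) (x : M)
    (u : Fin k → TangentSpace 𝓘(ℝ, E) x) : ℝ :=
  let y : E := extChartAt 𝓘(ℝ, E) x x
  let w : Fin k → E := fun i => mfderiv 𝓘(ℝ, E) 𝓘(ℝ, E) (extChartAt 𝓘(ℝ, E) x) x (u i)
  fderiv ℝ (localForm x α) y (localField x v y) w +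
    ∑ i, localForm x α y (Function.update w i (fderiv ℝ (localField x v) y (w i)))

variable [IsManifold 𝓘(ℝ, E) ∞ M]

theorem mdiff_symm (a : M) {y : E} (hy : y ∈ (extChartAt 𝓘(ℝ, E) a).target) :
    MDifferentiableAt 𝓘(ℝ, E) 𝓘(ℝ, E) (extChartAt 𝓘(ℝ, E) a).symm y :=
  ((contMDiffOn_extChartAt_symm (n := ∞) a).mdifferentiableOn (by simp)).mdifferentiableAt
    ((isOpen_extChartAt_target a).mem_nhds hy)

theorem mdiff_chart (a : M) {x : M} (hx : x ∈ (extChartAt 𝓘(ℝ, E) a).source) :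
    MDifferentiableAt 𝓘(ℝ, E) 𝓘(ℝ, E) (extChartAt 𝓘(ℝ, E) a) x :=
  ((contMDiffOn_extChartAt (n := ∞) (x := a)).mdifferentiableOn (by simp)).mdifferentiableAt
    (by rw [← extChartAt_source 𝓘(ℝ, E)]; exact (isOpen_extChartAt_source a).mem_nhds hx)

/-- Independence of the chart: local expressions of a form are related by pullback along the
transition maps. -/
theorem localForm_change {k : ℕ} (α : PreForm E M k) (a b : M) {y : E}
    (hy : y ∈ (extChartAt 𝓘(ℝ, E) a).target)
    (hb : (extChartAt 𝓘(ℝ, E) a).symm y ∈ (extChartAt 𝓘(ℝ, E) b).source) :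
    localForm a α y =
      (localForm b α
        (extChartAt 𝓘(ℝ, E) b ((extChartAt 𝓘(ℝ, E) a).symm y))).compContinuousLinearMap
      (fderiv ℝ (extChartAt 𝓘(ℝ, E) b ∘ (extChartAt 𝓘(ℝ, E) a).symm) y) := by
  set f : E → M := ⇑(extChartAt 𝓘(ℝ, E) a).symm with hf
  set h : M → E := ⇑(extChartAt 𝓘(ℝ, E) b) with hh
  set g : E → M := ⇑(extChartAt 𝓘(ℝ, E) b).symm with hg
  have hfy : MDifferentiableAt 𝓘(ℝ, E) 𝓘(ℝ, E) f y := mdiff_symm a hy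
  have hhy : MDifferentiableAt 𝓘(ℝ, E) 𝓘(ℝ, E) h (f y) := mdiff_chart b hb
  have hgy : MDifferentiableAt 𝓘(ℝ, E) 𝓘(ℝ, E) g ((h ∘ f) y) :=
    mdiff_symm b ((extChartAt 𝓘(ℝ, E) b).map_source hb)
  have hev : f =ᶠ[nhds y] g ∘ (h ∘ f) := by
    have hc : ContinuousAt f y := hfy.continuousAt
    filter_upwards [hc.preimage_mem_nhds ((isOpen_extChartAt_source b).mem_nhds hb)] with z hz
    exact ((extChartAt 𝓘(ℝ, E) b).left_inv hz).symm
  have h1 : mfderiv 𝓘(ℝ, E) 𝓘(ℝ, E) f y = (mfderiv 𝓘(ℝ, E) 𝓘(ℝ, E) g ((h ∘ f) y)).comp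
      (mfderiv 𝓘(ℝ, E) 𝓘(ℝ, E) (h ∘ f) y) :=
    hev.mfderiv_eq.trans (mfderiv_comp y hgy (hhy.comp y hfy))
  have h2 : f y = g ((h ∘ f) y) := hev.eq_of_nhds
  rw [mfderiv_eq_fderiv] at h1
  let G : M → (E →L[ℝ] E) → E [⋀^Fin k]→L[ℝ] ℝ := fun p L =>
    ContinuousAlternatingMap.compContinuousLinearMap (M := E) (M' := E) (α p) L
  change G (f y) (mfderiv 𝓘(ℝ, E) 𝓘(ℝ, E) f y) =
    (G (g ((h ∘ f) y)) (mfderiv 𝓘(ℝ, E) 𝓘(ℝ, E) g ((h ∘ f) y))).compContinuousLinearMap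
      (fderiv ℝ (h ∘ f) y)
  exact (congrArg₂ G h2 h1).trans rfl

theorem transition_contDiffAt (a b : M) {y : E}
    (hy : y ∈ (extChartAt 𝓘(ℝ, E) a).target)
    (hb : (extChartAt 𝓘(ℝ, E) a).symm y ∈ (extChartAt 𝓘(ℝ, E) b).source) :
    ContDiffAt ℝ ∞ (extChartAt 𝓘(ℝ, E) b ∘ (extChartAt 𝓘(ℝ, E) a).symm) y := by
  rw [← contMDiffAt_iff_contDiffAt]
  refine ContMDiffAt.comp y ?_ ((contMDiffOn_extChartAt_symm (n := ∞) a).contMDiffAt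
    ((isOpen_extChartAt_target a).mem_nhds hy))
  exact contMDiffAt_extChartAt' (by rwa [extChartAt_source] at hb)

/-- The exterior derivative may be computed in any chart. -/
theorem localForm_extD {k : ℕ} {α : PreForm E M k} (hα : IsSmooth α) (a : M) {y : E}
    (hy : y ∈ (extChartAt 𝓘(ℝ, E) a).target) :
    localForm a (extD α) y = extDeriv (localForm a α) y := by
  set f : E → M := ⇑(extChartAt 𝓘(ℝ, E) a).symm with hf
  set b : M := f y with hbdef
  have hb : f y ∈ (extChartAt 𝓘(ℝ, E) b).source := mem_extChartAt_source b
  have hfy : MDifferentiableAt 𝓘(ℝ, E) 𝓘(ℝ, E) f y := mdiff_symm a hy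
  have hhy : MDifferentiableAt 𝓘(ℝ, E) 𝓘(ℝ, E) (extChartAt 𝓘(ℝ, E) b) (f y) := mdiff_chart b hb
  have h1 : localForm a (extD α) y =
      (extDeriv (localForm b α) (extChartAt 𝓘(ℝ, E) b (f y))).compContinuousLinearMap
        (fderiv ℝ (extChartAt 𝓘(ℝ, E) b ∘ f) y) := by
    have h2 := mfderiv_comp y hhy hfy
    rw [mfderiv_eq_fderiv] at h2
    rw [h2]
    rfl
  have h3 : localForm a α =ᶠ[nhds y] fun z =>
      (localForm b α ((extChartAt 𝓘(ℝ, E) b ∘ f) z)).compContinuousLinearMap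
        (fderiv ℝ (extChartAt 𝓘(ℝ, E) b ∘ f) z) := by
    filter_upwards [(isOpen_extChartAt_target a).mem_nhds hy,
      hfy.continuousAt.preimage_mem_nhds ((isOpen_extChartAt_source b).mem_nhds hb)] with z hz hz'
    exact localForm_change α a b hz hz'
  rw [h1, h3.extDeriv_eq]
  exact (extDeriv_pullback (r := ∞) (f := extChartAt 𝓘(ℝ, E) b ∘ f)
    ((localForm_contDiffAt hα b ((extChartAt 𝓘(ℝ, E) b).map_source hb)).differentiableAt (by simp))
    (transition_contDiffAt a b hy hb) two_le).symm

theorem IsSmooth.extD {k : ℕ} {α : PreForm E M k} (hα : IsSmooth α) : IsSmooth (extD α) := by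
  intro a
  have h : ContDiffOn ℝ ∞ (fun y => ContinuousAlternatingMap.alternatizeUncurryFinCLM ℝ E ℝ
      (fderiv ℝ (localForm a α) y)) (extChartAt 𝓘(ℝ, E) a).target :=
    (ContinuousLinearMap.contDiff _).comp_contDiffOn
      ((hα a).fderiv_of_isOpen (isOpen_extChartAt_target a) (by simp))
  exact h.congr fun y hy => localForm_extD hα a hy

theorem extD_extD {k : ℕ} {α : PreForm E M k} (hα : IsSmooth α) : extD (extD α) = 0 := by
  funext x
  have hx := mem_extChartAt_target (I := 𝓘(ℝ, E)) x
  have h : localForm x (ThreePlectic.extD α) =ᶠ[nhds (extChartAt 𝓘(ℝ, E) x x)]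
      extDeriv (localForm x α) := by
    filter_upwards [(isOpen_extChartAt_target x).mem_nhds hx] with z hz
    exact localForm_extD hα x hz
  have h0 : extDeriv (localForm x (ThreePlectic.extD α)) (extChartAt 𝓘(ℝ, E) x x) = 0 := by
    rw [h.extDeriv_eq]
    exact extDeriv_extDeriv_apply (localForm_contDiffAt hα x hx) two_le
  change ContinuousAlternatingMap.compContinuousLinearMap _ _ = 0
  rw [h0]
  ext v
  rfl

/-- The de Rham differential `Ω^k(M) → Ω^{k+1}(M)`. -/
def deRham (k : ℕ) : Form E M k →ₗ[ℝ] Form E M (k + 1) where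
  toFun α := ⟨extD α.1, IsSmooth.extD α.2⟩
  map_add' α β := Subtype.ext (extD_add α.2 β.2)
  map_smul' c α := Subtype.ext (extD_smul c α.1)

theorem deRham_deRham {k : ℕ} (α : Form E M k) : deRham (k + 1) (deRham k α) = 0 :=
  Subtype.ext (extD_extD α.2)

variable (E M) in
/-- Smooth vector fields. -/
abbrev VectorField : Type (max u v) :=
  ContMDiffSection 𝓘(ℝ, E) E ∞ (TangentSpace 𝓘(ℝ, E) : M → Type u)

/-- An `n`-plectic form: a closed, non-degenerate `(n+1)`-form. -/
structure IsPlectic (n : ℕ) (ϖ : Form E M (n + 1)) : Prop where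
  closed : deRham (n + 1) ϖ = 0
  nondegenerate : ∀ (x : M) (v : TangentSpace 𝓘(ℝ, E) x),
    ContinuousAlternatingMap.curryLeft (E := E) (ϖ.1 x) v = 0 → v = 0

/-- `v` is a Hamiltonian vector field of the form `α`, that is, `dα = -ι(v)ϖ`. -/
def IsHamiltonianField {m : ℕ} (ϖ : Form E M (m + 2)) (α : Form E M m) (v : VectorField E M) :
    Prop :=
  (deRham m α).1 = -contract (fun x => v x) ϖ.1

/-- The space of Hamiltonian forms. -/
def hamiltonianForms {m : ℕ} (ϖ : Form E M (m + 2)) : Submodule ℝ (Form E M m) where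
  carrier := {α | ∃ v : VectorField E M, IsHamiltonianField ϖ α v}
  add_mem' := by
    rintro α β ⟨v, hv⟩ ⟨w, hw⟩
    refine ⟨v + w, ?_⟩
    have h : (deRham m (α + β)).1 = (deRham m α).1 + (deRham m β).1 := by rw [map_add]; rfl
    rw [IsHamiltonianField, h, hv, hw, ← neg_add]
    refine congrArg _ (funext fun x => ?_)
    exact (map_add (ContinuousAlternatingMap.curryLeft (E := E) (ϖ.1 x)) (v x) (w x)).symm
  zero_mem' := by
    refine ⟨0, ?_⟩
    have h : (deRham m (0 : Form E M m)).1 = 0 := by rw [map_zero]; rfl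
    rw [IsHamiltonianField, h, eq_comm, neg_eq_zero]
    exact funext fun x => map_zero (ContinuousAlternatingMap.curryLeft (E := E) (ϖ.1 x))
  smul_mem' := by
    rintro c α ⟨v, hv⟩
    refine ⟨c • v, ?_⟩
    have h : (deRham m (c • α)).1 = c • (deRham m α).1 := by rw [map_smul]; rfl
    rw [IsHamiltonianField, h, hv, smul_neg]
    refine congrArg _ (funext fun x => ?_)
    exact (map_smul (ContinuousAlternatingMap.curryLeft (E := E) (ϖ.1 x)) c (v x)).symm

theorem deRham_mem_hamiltonianForms {m : ℕ} (ϖ : Form E M (m + 3)) (β : Form E M m) :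
    deRham m β ∈ hamiltonianForms ϖ := by
  refine ⟨0, ?_⟩
  have h : (deRham (m + 1) (deRham m β)).1 = 0 := by rw [deRham_deRham]; rfl
  rw [IsHamiltonianField, h, eq_comm, neg_eq_zero]
  exact funext fun x => map_zero (ContinuousAlternatingMap.curryLeft (E := E) (ϖ.1 x))

open Classical in
/-- The Hamiltonian vector field `v_α` of a form `α`, which is unique for a non-degenerate `ϖ`
(and `0` if `α` is not Hamiltonian). -/
def hamiltonianField {m : ℕ} (ϖ : Form E M (m + 2)) (α : Form E M m) : VectorField E M :=
  if h : ∃ v : VectorField E M, IsHamiltonianField ϖ α v then h.choose else 0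

/-! ## The two structures on a 3-plectic manifold -/

/-- The complex `Ω²_Ham(M) ← Ω¹(M) ← Ω⁰(M)` with the de Rham differential. -/
def plecticComplex (ϖ : Form E M 4) : ThreeTermComplex.{0, max u v} ℝ where
  L0 := hamiltonianForms (m := 2) ϖ
  L1 := Form E M 1
  L2 := Form E M 0
  d1 := (deRham 1).codRestrict (hamiltonianForms (m := 2) ϖ)
    fun β => deRham_mem_hamiltonianForms (m := 1) ϖ β
  d2 := deRham 0
  d1_comp_d2 := by
    ext1 f
    exact Subtype.ext (deRham_deRham f)

namespace plecticComplex

variable {ϖ : Form E M 4}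

/-- The component of degree `0`, as a smooth 2-form. -/
def hamForm (a : (plecticComplex ϖ).Tot) : Form E M 2 :=
  Subtype.val (show hamiltonianForms (m := 2) ϖ from a.1)

/-- The component of degree `0`, a Hamiltonian 2-form. -/
def form0 (a : (plecticComplex ϖ).Tot) : PreForm E M 2 :=
  Subtype.val (hamForm a)

/-- The component of degree `1`, a 1-form. -/
def form1 (a : (plecticComplex ϖ).Tot) : PreForm E M 1 :=
  Subtype.val (show Form E M 1 from a.2.1)

/-- The component of degree `2`, a 0-form, that is, a smooth function. -/
def form2 (a : (plecticComplex ϖ).Tot) : PreForm E M 0 :=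
  Subtype.val (show Form E M 0 from a.2.2)

/-- The Hamiltonian vector field of the degree `0` component; the components of positive degree
have Hamiltonian vector field `0` by convention. -/
def field (a : (plecticComplex ϖ).Tot) (x : M) : TangentSpace 𝓘(ℝ, E) x :=
  hamiltonianField (m := 2) ϖ (hamForm a) x

end plecticComplex

open plecticComplex

/-- The weak Lie 3-algebra structure is the one of `L_∞(M, ϖ)`:
`λ₂(α, β) = ι(v_α, v_β)ϖ`, `λ₃(α, β, γ) = -ι(v_α, v_β, v_γ)ϖ`,
`λ₄(α, β, γ, η) = -ι(v_α, v_β, v_γ, v_η)ϖ`, and the remaining structure maps vanish.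
Here `ι(v₁, …, vₖ)ϖ = ι(vₖ) ⋯ ι(v₁)ϖ = ϖ(v₁, …, vₖ, ⋅)`. -/
structure IsLInfinity (ϖ : Form E M 4) (A : WeakLie3Algebra (plecticComplex ϖ)) : Prop where
  l2 : ∀ a b : (plecticComplex ϖ).Tot,
    form0 (A.l2.toMap ![a, b]) = contract (field b) (contract (field a) ϖ.1) ∧
    form1 (A.l2.toMap ![a, b]) = 0 ∧
    form2 (A.l2.toMap ![a, b]) = 0
  l3 : ∀ a b c : (plecticComplex ϖ).Tot,
    form0 (A.l3.toMap ![a, b, c]) = 0 ∧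
    form1 (A.l3.toMap ![a, b, c]) =
      -contract (field c) (contract (field b) (contract (field a) ϖ.1)) ∧
    form2 (A.l3.toMap ![a, b, c]) = 0
  l4 : ∀ a b c e : (plecticComplex ϖ).Tot,
    form0 (A.l4.toMap ![a, b, c, e]) = 0 ∧
    form1 (A.l4.toMap ![a, b, c, e]) = 0 ∧
    form2 (A.l4.toMap ![a, b, c, e]) =
      -contract (field e) (contract (field c) (contract (field b) (contract (field a) ϖ.1)))
  l21 : A.l21.toMap = 0
  l211 : A.l211.toMap = 0
  l31 : A.l31.toMap = 0
  l32 : A.l32.toMap = 0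

/-- The weak Lie 3-algebra structure is the one of the dg Leibniz algebra `Leib(M, ϖ)` with its
alternator: `λ₂(α, β)` is the Lie derivative of `β` along `v_α`,
`λ_{2;1}(α, β) = ι(v_α)β + ι(v_β)α`, and the remaining structure maps vanish. -/
structure IsLeib (ϖ : Form E M 4) (B : WeakLie3Algebra (plecticComplex ϖ)) : Prop where
  l2 : ∀ a b : (plecticComplex ϖ).Tot,
    (∀ x u, form0 (B.l2.toMap ![a, b]) x u = lieDeriv (field a) (form0 b) x u) ∧
    (∀ x u, form1 (B.l2.toMap ![a, b]) x u = lieDeriv (field a) (form1 b) x u) ∧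
    (∀ x u, form2 (B.l2.toMap ![a, b]) x u = lieDeriv (field a) (form2 b) x u)
  l21 : ∀ a b : (plecticComplex ϖ).Tot,
    form0 (B.l21.toMap ![a, b]) = 0 ∧
    form1 (B.l21.toMap ![a, b]) = contract (field a) (form0 b) + contract (field b) (form0 a) ∧
    form2 (B.l21.toMap ![a, b]) = contract (field a) (form1 b) + contract (field b) (form1 a)
  l211 : B.l211.toMap = 0
  l3 : B.l3.toMap = 0
  l31 : B.l31.toMap = 0
  l32 : B.l32.toMap = 0
  l4 : B.l4.toMap = 0

/-- The weak morphism has the components `f₁ = id`, `f₂(α, β) = -ι(v_α)β`, `f_{2;1} = 0` and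
`f₃(α, β, γ) = -ι(v_α, v_β)γ`. -/
structure IsComparison {ϖ : Form E M 4} {A B : WeakLie3Algebra (plecticComplex ϖ)}
    (f : WeakMorphism A B) : Prop where
  f1 : ∀ a : (plecticComplex ϖ).Tot, f.f1.toMap ![a] = a
  f2 : ∀ a b : (plecticComplex ϖ).Tot,
    form0 (f.f2.toMap ![a, b]) = 0 ∧
    form1 (f.f2.toMap ![a, b]) = -contract (field a) (form0 b) ∧
    form2 (f.f2.toMap ![a, b]) = -contract (field a) (form1 b)
  f21 : f.f21.toMap = 0
  f3 : ∀ a b c : (plecticComplex ϖ).Tot,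
    form0 (f.f3.toMap ![a, b, c]) = 0 ∧
    form1 (f.f3.toMap ![a, b, c]) = 0 ∧
    form2 (f.f3.toMap ![a, b, c]) = -contract (field b) (contract (field a) (form0 c))

end Geometry

end ThreePlectic

end

noncomputable section

namespace ThreePlectic

universe u v

/-! ### Evaluation of compositions and differentials on concrete tuples. -/

section Evaluation
variable {R : Type u} [CommRing R] {C D F : ThreeTermComplex.{u, v} R} {p q r s : ℤ} {n m k : ℕ}

/-! Everything follows formally from Cartan's calculus. As ω is closed and dα = -ι(v_α)ω, the forms
ι(v_α)ω are closed, and L(v)ι(w) = ι(w)L(v) + ι([v,w]) applied to ω shows that λ₂(α,β) is again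
Hamiltonian, with field [v_α,v_β]. Brackets of vector fields can therefore be replaced by λ₂ in
every formula, and the geometry condenses to two bilinear operations on the total complex, `ι a b` =
ι(v_a)b and `lam a b` = λ₂(a,b), subject to the few identities gathered in `CartanCalculus`.

The complex truncates the de Rham complex: its differential vanishes on Hamiltonian 2-forms. Since
dβ = -ι(v_β)ω there, the missing term ι(v_α)dβ of Cartan's formula is exactly λ₂(α,β). On the
complex one thus has L = dι + ιd + λ₂ (`d_ι`), which says that f₂ = -ι is a homotopy between λ₂ and
the Lie derivative.

Every relation is then checked by moving d inwards with `d_ι`, moving L inwards with the commutator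
rules `lie_ι_right` and `lie_lam_right`, and sorting with antisymmetry. The identities that need
thought are `lie_lie` (the Leibniz identity of L), `d_ι_ι_lam` and `cocycle` (the relations for λ₄),
and `cartan_three` (the arity four relation of f). The last two express that three successive
contractions vanish for degree reasons. As f₁ = id, the inverse is explicit: it has second component
-f₂ and the same third component as f.

The identities of `CartanCalculus` come from `extDeriv_curryLeft_add` and `lieAt_curryLeft` on a
normed space, carried to the manifold by charts; non-degeneracy enters through the uniqueness, hence
linearity, of Hamiltonian fields. -/

@[simp]
theorem GMap.circ_two_zero_two (f : GMap C D p 2) (g : GMap C C q 2) (x : Fin 3 → ℤ × C.Tot) :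
    f.circ (m := 1) 0 g x = f.toMap ![g.toMap ![(x 0).2, (x 1).2], (x 2).2] := by
  -- Nothing stands to the left of slot 0, so the Koszul sign is that of an empty sum.
  refine (congrArg₂ (fun (a : ℤˣ) (b : D.Tot) => a • b) (by simp)
    (congrArg f.toMap (funext fun j => ?_))).trans (one_smul _ _)
  fin_cases j
  · exact congrArg g.toMap (funext fun t => by fin_cases t <;> rfl)
  · rfl

@[simp]
theorem GMap.circ_two_one_two (f : GMap C D p 2) (g : GMap C C q 2) (x : Fin 3 → ℤ × C.Tot) :
    f.circ (m := 1) 1 g x = (q * (x 0).1).negOnePow •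
      f.toMap ![(x 0).2, g.toMap ![(x 1).2, (x 2).2]] := by
  refine (congrArg₂ (fun (a : ℤˣ) (b : D.Tot) => a • b) (by simp)
    (congrArg f.toMap (funext fun j => ?_)))
  fin_cases j
  · rfl
  · exact congrArg g.toMap (funext fun t => by fin_cases t <;> rfl)

@[simp]
theorem GMap.circ_two_zero_three (f : GMap C D p 2) (g : GMap C C q 3) (x : Fin 4 → ℤ × C.Tot) :
    f.circ (m := 1) 0 g x = f.toMap ![g.toMap ![(x 0).2, (x 1).2, (x 2).2], (x 3).2] := by
  refine (congrArg₂ (fun (a : ℤˣ) (b : D.Tot) => a • b) (by simp)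
    (congrArg f.toMap (funext fun j => ?_))).trans (one_smul _ _)
  fin_cases j
  · exact congrArg g.toMap (funext fun t => by fin_cases t <;> rfl)
  · rfl

@[simp]
theorem GMap.circ_two_one_three (f : GMap C D p 2) (g : GMap C C q 3) (x : Fin 4 → ℤ × C.Tot) :
    f.circ (m := 1) 1 g x = (q * (x 0).1).negOnePow •
      f.toMap ![(x 0).2, g.toMap ![(x 1).2, (x 2).2, (x 3).2]] := by
  refine (congrArg₂ (fun (a : ℤˣ) (b : D.Tot) => a • b) (by simp)
    (congrArg f.toMap (funext fun j => ?_)))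
  fin_cases j
  · rfl
  · exact congrArg g.toMap (funext fun t => by fin_cases t <;> rfl)

@[simp]
theorem GMap.circ_two_zero_four (f : GMap C D p 2) (g : GMap C C q 4) (x : Fin 5 → ℤ × C.Tot) :
    f.circ (m := 1) 0 g x = f.toMap ![g.toMap ![(x 0).2, (x 1).2, (x 2).2, (x 3).2], (x 4).2] := by
  refine (congrArg₂ (fun (a : ℤˣ) (b : D.Tot) => a • b) (by simp)
    (congrArg f.toMap (funext fun j => ?_))).trans (one_smul _ _)
  fin_cases j
  · exact congrArg g.toMap (funext fun t => by fin_cases t <;> rfl)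
  · rfl

@[simp]
theorem GMap.circ_two_one_four (f : GMap C D p 2) (g : GMap C C q 4) (x : Fin 5 → ℤ × C.Tot) :
    f.circ (m := 1) 1 g x = (q * (x 0).1).negOnePow •
      f.toMap ![(x 0).2, g.toMap ![(x 1).2, (x 2).2, (x 3).2, (x 4).2]] := by
  refine (congrArg₂ (fun (a : ℤˣ) (b : D.Tot) => a • b) (by simp)
    (congrArg f.toMap (funext fun j => ?_)))
  fin_cases j
  · rfl
  · exact congrArg g.toMap (funext fun t => by fin_cases t <;> rfl)

@[simp]
theorem GMap.circ_three_zero_two (f : GMap C D p 3) (g : GMap C C q 2) (x : Fin 4 → ℤ × C.Tot) :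
    f.circ (m := 2) 0 g x = f.toMap ![g.toMap ![(x 0).2, (x 1).2], (x 2).2, (x 3).2] := by
  refine (congrArg₂ (fun (a : ℤˣ) (b : D.Tot) => a • b) (by simp)
    (congrArg f.toMap (funext fun j => ?_))).trans (one_smul _ _)
  fin_cases j
  · exact congrArg g.toMap (funext fun t => by fin_cases t <;> rfl)
  · rfl
  · rfl

@[simp]
theorem GMap.circ_three_one_two (f : GMap C D p 3) (g : GMap C C q 2) (x : Fin 4 → ℤ × C.Tot) :
    f.circ (m := 2) 1 g x = (q * (x 0).1).negOnePow •
      f.toMap ![(x 0).2, g.toMap ![(x 1).2, (x 2).2], (x 3).2] := by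
  refine (congrArg₂ (fun (a : ℤˣ) (b : D.Tot) => a • b) (by simp)
    (congrArg f.toMap (funext fun j => ?_)))
  fin_cases j
  · rfl
  · exact congrArg g.toMap (funext fun t => by fin_cases t <;> rfl)
  · rfl

@[simp]
theorem GMap.circ_three_two_two (f : GMap C D p 3) (g : GMap C C q 2) (x : Fin 4 → ℤ × C.Tot) :
    f.circ (m := 2) 2 g x = (q * ((x 0).1 + (x 1).1)).negOnePow •
      f.toMap ![(x 0).2, (x 1).2, g.toMap ![(x 2).2, (x 3).2]] := by
  refine (congrArg₂ (fun (a : ℤˣ) (b : D.Tot) => a • b) (by simp [Fin.sum_univ_succ])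
    (congrArg f.toMap (funext fun j => ?_)))
  fin_cases j
  · rfl
  · rfl
  · exact congrArg g.toMap (funext fun t => by fin_cases t <;> rfl)

@[simp]
theorem GMap.circ_three_zero_three (f : GMap C D p 3) (g : GMap C C q 3) (x : Fin 5 → ℤ × C.Tot) :
    f.circ (m := 2) 0 g x = f.toMap ![g.toMap ![(x 0).2, (x 1).2, (x 2).2], (x 3).2, (x 4).2] := by
  refine (congrArg₂ (fun (a : ℤˣ) (b : D.Tot) => a • b) (by simp)
    (congrArg f.toMap (funext fun j => ?_))).trans (one_smul _ _)
  fin_cases j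
  · exact congrArg g.toMap (funext fun t => by fin_cases t <;> rfl)
  · rfl
  · rfl

@[simp]
theorem GMap.circ_three_one_three (f : GMap C D p 3) (g : GMap C C q 3) (x : Fin 5 → ℤ × C.Tot) :
    f.circ (m := 2) 1 g x = (q * (x 0).1).negOnePow •
      f.toMap ![(x 0).2, g.toMap ![(x 1).2, (x 2).2, (x 3).2], (x 4).2] := by
  refine (congrArg₂ (fun (a : ℤˣ) (b : D.Tot) => a • b) (by simp)
    (congrArg f.toMap (funext fun j => ?_)))
  fin_cases j
  · rfl
  · exact congrArg g.toMap (funext fun t => by fin_cases t <;> rfl)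
  · rfl

@[simp]
theorem GMap.circ_three_two_three (f : GMap C D p 3) (g : GMap C C q 3) (x : Fin 5 → ℤ × C.Tot) :
    f.circ (m := 2) 2 g x = (q * ((x 0).1 + (x 1).1)).negOnePow •
      f.toMap ![(x 0).2, (x 1).2, g.toMap ![(x 2).2, (x 3).2, (x 4).2]] := by
  refine (congrArg₂ (fun (a : ℤˣ) (b : D.Tot) => a • b) (by simp [Fin.sum_univ_succ])
    (congrArg f.toMap (funext fun j => ?_)))
  fin_cases j
  · rfl
  · rfl
  · exact congrArg g.toMap (funext fun t => by fin_cases t <;> rfl)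

@[simp]
theorem GMap.circ_four_zero_two (f : GMap C D p 4) (g : GMap C C q 2) (x : Fin 5 → ℤ × C.Tot) :
    f.circ (m := 3) 0 g x = f.toMap ![g.toMap ![(x 0).2, (x 1).2], (x 2).2, (x 3).2, (x 4).2] := by
  refine (congrArg₂ (fun (a : ℤˣ) (b : D.Tot) => a • b) (by simp)
    (congrArg f.toMap (funext fun j => ?_))).trans (one_smul _ _)
  fin_cases j
  · exact congrArg g.toMap (funext fun t => by fin_cases t <;> rfl)
  · rfl
  · rfl
  · rfl

@[simp]
theorem GMap.circ_four_one_two (f : GMap C D p 4) (g : GMap C C q 2) (x : Fin 5 → ℤ × C.Tot) :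
    f.circ (m := 3) 1 g x = (q * (x 0).1).negOnePow •
      f.toMap ![(x 0).2, g.toMap ![(x 1).2, (x 2).2], (x 3).2, (x 4).2] := by
  refine (congrArg₂ (fun (a : ℤˣ) (b : D.Tot) => a • b) (by simp)
    (congrArg f.toMap (funext fun j => ?_)))
  fin_cases j
  · rfl
  · exact congrArg g.toMap (funext fun t => by fin_cases t <;> rfl)
  · rfl
  · rfl

@[simp]
theorem GMap.circ_four_two_two (f : GMap C D p 4) (g : GMap C C q 2) (x : Fin 5 → ℤ × C.Tot) :
    f.circ (m := 3) 2 g x = (q * ((x 0).1 + (x 1).1)).negOnePow •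
      f.toMap ![(x 0).2, (x 1).2, g.toMap ![(x 2).2, (x 3).2], (x 4).2] := by
  refine (congrArg₂ (fun (a : ℤˣ) (b : D.Tot) => a • b) (by simp [Fin.sum_univ_succ])
    (congrArg f.toMap (funext fun j => ?_)))
  fin_cases j
  · rfl
  · rfl
  · exact congrArg g.toMap (funext fun t => by fin_cases t <;> rfl)
  · rfl

@[simp]
theorem GMap.circ_four_three_two (f : GMap C D p 4) (g : GMap C C q 2) (x : Fin 5 → ℤ × C.Tot) :
    f.circ (m := 3) 3 g x = (q * ((x 0).1 + (x 1).1 + (x 2).1)).negOnePow •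
      f.toMap ![(x 0).2, (x 1).2, (x 2).2, g.toMap ![(x 3).2, (x 4).2]] := by
  refine (congrArg₂ (fun (a : ℤˣ) (b : D.Tot) => a • b) (by simp [Fin.sum_univ_succ, add_assoc])
    (congrArg f.toMap (funext fun j => ?_)))
  fin_cases j
  · rfl
  · rfl
  · rfl
  · exact congrArg g.toMap (funext fun t => by fin_cases t <;> rfl)

@[simp]
theorem GMap.comp2_one_two (h : GMap D F p 2) (g₁ : GMap C D q 1) (g₂ : GMap C D r 2)
    (x : Fin 3 → ℤ × C.Tot) : h.comp2 g₁ g₂ x = (r * (x 0).1).negOnePow •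
      h.toMap ![g₁.toMap ![(x 0).2], g₂.toMap ![(x 1).2, (x 2).2]] := by
  refine congrArg₂ (fun (a : ℤˣ) (b : F.Tot) => a • b) (by rw [Fin.sum_univ_one]; rfl)
    (congrArg h.toMap (funext fun j => ?_))
  fin_cases j
  · exact congrArg g₁.toMap (funext fun t => by fin_cases t; rfl)
  · exact congrArg g₂.toMap (funext fun t => by fin_cases t <;> rfl)

@[simp]
theorem GMap.comp2_two_one (h : GMap D F p 2) (g₁ : GMap C D q 2) (g₂ : GMap C D r 1)
    (x : Fin 3 → ℤ × C.Tot) : h.comp2 g₁ g₂ x = (r * ((x 0).1 + (x 1).1)).negOnePow •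
      h.toMap ![g₁.toMap ![(x 0).2, (x 1).2], g₂.toMap ![(x 2).2]] := by
  refine congrArg₂ (fun (a : ℤˣ) (b : F.Tot) => a • b) (by rw [Fin.sum_univ_two]; rfl)
    (congrArg h.toMap (funext fun j => ?_))
  fin_cases j
  · exact congrArg g₁.toMap (funext fun t => by fin_cases t <;> rfl)
  · exact congrArg g₂.toMap (funext fun t => by fin_cases t; rfl)

@[simp]
theorem GMap.comp2_one_three (h : GMap D F p 2) (g₁ : GMap C D q 1) (g₂ : GMap C D r 3)
    (x : Fin 4 → ℤ × C.Tot) : h.comp2 g₁ g₂ x = (r * (x 0).1).negOnePow •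
      h.toMap ![g₁.toMap ![(x 0).2], g₂.toMap ![(x 1).2, (x 2).2, (x 3).2]] := by
  refine congrArg₂ (fun (a : ℤˣ) (b : F.Tot) => a • b) (by rw [Fin.sum_univ_one]; rfl)
    (congrArg h.toMap (funext fun j => ?_))
  fin_cases j
  · exact congrArg g₁.toMap (funext fun t => by fin_cases t; rfl)
  · exact congrArg g₂.toMap (funext fun t => by fin_cases t <;> rfl)

@[simp]
theorem GMap.comp2_three_one (h : GMap D F p 2) (g₁ : GMap C D q 3) (g₂ : GMap C D r 1)
    (x : Fin 4 → ℤ × C.Tot) : h.comp2 g₁ g₂ x = (r * ((x 0).1 + (x 1).1 + (x 2).1)).negOnePow •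
      h.toMap ![g₁.toMap ![(x 0).2, (x 1).2, (x 2).2], g₂.toMap ![(x 3).2]] := by
  refine congrArg₂ (fun (a : ℤˣ) (b : F.Tot) => a • b) (by rw [Fin.sum_univ_three]; rfl)
    (congrArg h.toMap (funext fun j => ?_))
  fin_cases j
  · exact congrArg g₁.toMap (funext fun t => by fin_cases t <;> rfl)
  · exact congrArg g₂.toMap (funext fun t => by fin_cases t; rfl)

@[simp]
theorem GMap.comp2_two_two (h : GMap D F p 2) (g₁ : GMap C D q 2) (g₂ : GMap C D r 2)
    (x : Fin 4 → ℤ × C.Tot) : h.comp2 g₁ g₂ x = (r * ((x 0).1 + (x 1).1)).negOnePow •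
      h.toMap ![g₁.toMap ![(x 0).2, (x 1).2], g₂.toMap ![(x 2).2, (x 3).2]] := by
  refine congrArg₂ (fun (a : ℤˣ) (b : F.Tot) => a • b) (by rw [Fin.sum_univ_two]; rfl)
    (congrArg h.toMap (funext fun j => ?_))
  fin_cases j
  · exact congrArg g₁.toMap (funext fun t => by fin_cases t <;> rfl)
  · exact congrArg g₂.toMap (funext fun t => by fin_cases t <;> rfl)

@[simp]
theorem GMap.comp3_two_one_one (h : GMap D F p 3) (g₁ : GMap C D q 2) (g₂ : GMap C D r 1)
    (g₃ : GMap C D s 1) (x : Fin 4 → ℤ × C.Tot) : h.comp3 g₁ g₂ g₃ x =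
      (r * ((x 0).1 + (x 1).1) + s * ((x 0).1 + (x 1).1 + (x 2).1)).negOnePow •
      h.toMap ![g₁.toMap ![(x 0).2, (x 1).2], g₂.toMap ![(x 2).2], g₃.toMap ![(x 3).2]] := by
  refine congrArg₂ (fun (a : ℤˣ) (b : F.Tot) => a • b)
    (by rw [Fin.sum_univ_two, Fin.sum_univ_three]; rfl) (congrArg h.toMap (funext fun j => ?_))
  fin_cases j
  · exact congrArg g₁.toMap (funext fun t => by fin_cases t <;> rfl)
  · exact congrArg g₂.toMap (funext fun t => by fin_cases t; rfl)
  · exact congrArg g₃.toMap (funext fun t => by fin_cases t; rfl)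

@[simp]
theorem GMap.comp3_one_two_one (h : GMap D F p 3) (g₁ : GMap C D q 1) (g₂ : GMap C D r 2)
    (g₃ : GMap C D s 1) (x : Fin 4 → ℤ × C.Tot) : h.comp3 g₁ g₂ g₃ x =
      (r * (x 0).1 + s * ((x 0).1 + (x 1).1 + (x 2).1)).negOnePow •
      h.toMap ![g₁.toMap ![(x 0).2], g₂.toMap ![(x 1).2, (x 2).2], g₃.toMap ![(x 3).2]] := by
  refine congrArg₂ (fun (a : ℤˣ) (b : F.Tot) => a • b)
    (by rw [Fin.sum_univ_one, Fin.sum_univ_three]; rfl) (congrArg h.toMap (funext fun j => ?_))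
  fin_cases j
  · exact congrArg g₁.toMap (funext fun t => by fin_cases t; rfl)
  · exact congrArg g₂.toMap (funext fun t => by fin_cases t <;> rfl)
  · exact congrArg g₃.toMap (funext fun t => by fin_cases t; rfl)

@[simp]
theorem GMap.comp3_one_one_two (h : GMap D F p 3) (g₁ : GMap C D q 1) (g₂ : GMap C D r 1)
    (g₃ : GMap C D s 2) (x : Fin 4 → ℤ × C.Tot) : h.comp3 g₁ g₂ g₃ x =
      (r * (x 0).1 + s * ((x 0).1 + (x 1).1)).negOnePow •
      h.toMap ![g₁.toMap ![(x 0).2], g₂.toMap ![(x 1).2], g₃.toMap ![(x 2).2, (x 3).2]] := by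
  refine congrArg₂ (fun (a : ℤˣ) (b : F.Tot) => a • b)
    (by rw [Fin.sum_univ_one, Fin.sum_univ_two]; rfl) (congrArg h.toMap (funext fun j => ?_))
  fin_cases j
  · exact congrArg g₁.toMap (funext fun t => by fin_cases t; rfl)
  · exact congrArg g₂.toMap (funext fun t => by fin_cases t; rfl)
  · exact congrArg g₃.toMap (funext fun t => by fin_cases t <;> rfl)

@[simp]
theorem GMap.compDiag_one (h : GMap D F p 1) (g : GMap C D 0 1) (x : Fin 1 → ℤ × C.Tot) :
    h.compDiag g x = h.toMap ![g.toMap ![(x 0).2]] := by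
  refine congrArg h.toMap (funext fun j => ?_)
  fin_cases j; exact congrArg g.toMap (funext fun t => by fin_cases t; rfl)

@[simp]
theorem GMap.compDiag_two (h : GMap D F p 2) (g : GMap C D 0 1) (x : Fin 2 → ℤ × C.Tot) :
    h.compDiag g x = h.toMap ![g.toMap ![(x 0).2], g.toMap ![(x 1).2]] := by
  refine congrArg h.toMap (funext fun j => ?_)
  fin_cases j <;> exact congrArg g.toMap (funext fun t => by fin_cases t; rfl)

@[simp]
theorem GMap.compDiag_three (h : GMap D F p 3) (g : GMap C D 0 1) (x : Fin 3 → ℤ × C.Tot) :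
    h.compDiag g x = h.toMap ![g.toMap ![(x 0).2], g.toMap ![(x 1).2], g.toMap ![(x 2).2]] := by
  refine congrArg h.toMap (funext fun j => ?_)
  fin_cases j <;> exact congrArg g.toMap (funext fun t => by fin_cases t; rfl)

@[simp]
theorem GMap.compDiag_four (h : GMap D F p 4) (g : GMap C D 0 1) (x : Fin 4 → ℤ × C.Tot) :
    h.compDiag g x = h.toMap ![g.toMap ![(x 0).2], g.toMap ![(x 1).2], g.toMap ![(x 2).2],
      g.toMap ![(x 3).2]] := by
  refine congrArg h.toMap (funext fun j => ?_)
  fin_cases j <;> exact congrArg g.toMap (funext fun t => by fin_cases t; rfl)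

@[simp]
theorem GMap.bd_one (f : GMap C D p 1) (x : Fin 1 → ℤ × C.Tot) :
    f.bd x = D.d (f.toMap ![(x 0).2]) - p.negOnePow •
      (f.toMap ![C.d (x 0).2]) := by
  -- The degree recorded in the updated entry is irrelevant to `op`, which sees second components
  -- only.
  have h : ∀ i, f.op (Function.update x i ((x i).1 - 1, C.d (x i).2)) =
      f.toMap (Function.update (fun j => (x j).2) i (C.d (x i).2)) := fun i =>
    congrArg f.toMap (funext fun j => by by_cases hj : j = i <;> [(subst hj; simp); simp [hj]])
  have e : (fun j => (x j).2) = ![(x 0).2] :=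
    funext fun j => by fin_cases j <;> rfl
  have u : ∀ a,
      Function.update ![(x 0).2] 0 a = ![a] := fun a => by
    exact funext fun j => by fin_cases j <;> rfl
  simp only [GMap.bd, h]
  simp [e, GMap.op, Finset.sum_filter]
  rw [u]

@[simp]
theorem GMap.bd_two (f : GMap C D p 2) (x : Fin 2 → ℤ × C.Tot) :
    f.bd x = D.d (f.toMap ![(x 0).2, (x 1).2]) - p.negOnePow •
      (f.toMap ![C.d (x 0).2, (x 1).2] +
        ((x 0).1).negOnePow • f.toMap ![(x 0).2, C.d (x 1).2]) := by
  have h : ∀ i, f.op (Function.update x i ((x i).1 - 1, C.d (x i).2)) =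
      f.toMap (Function.update (fun j => (x j).2) i (C.d (x i).2)) := fun i =>
    congrArg f.toMap (funext fun j => by by_cases hj : j = i <;> [(subst hj; simp); simp [hj]])
  have e : (fun j => (x j).2) = ![(x 0).2, (x 1).2] :=
    funext fun j => by fin_cases j <;> rfl
  have u : ∀ a,
      Function.update ![(x 0).2, (x 1).2] 0 a = ![a, (x 1).2] ∧
      Function.update ![(x 0).2, (x 1).2] 1 a = ![(x 0).2, a] := fun a => by
    exact ⟨funext fun j => by fin_cases j <;> rfl, funext fun j => by fin_cases j <;> rfl⟩
  simp only [GMap.bd, h]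
  simp [e, u, GMap.op, Fin.sum_univ_succ, Finset.sum_filter]

@[simp]
theorem GMap.bd_three (f : GMap C D p 3) (x : Fin 3 → ℤ × C.Tot) :
    f.bd x = D.d (f.toMap ![(x 0).2, (x 1).2, (x 2).2]) - p.negOnePow •
      (f.toMap ![C.d (x 0).2, (x 1).2, (x 2).2] +
        ((x 0).1).negOnePow • f.toMap ![(x 0).2, C.d (x 1).2, (x 2).2] +
        ((x 0).1 + (x 1).1).negOnePow • f.toMap ![(x 0).2, (x 1).2, C.d (x 2).2]) := by
  have h : ∀ i, f.op (Function.update x i ((x i).1 - 1, C.d (x i).2)) =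
      f.toMap (Function.update (fun j => (x j).2) i (C.d (x i).2)) := fun i =>
    congrArg f.toMap (funext fun j => by by_cases hj : j = i <;> [(subst hj; simp); simp [hj]])
  have e : (fun j => (x j).2) = ![(x 0).2, (x 1).2, (x 2).2] :=
    funext fun j => by fin_cases j <;> rfl
  have u : ∀ a,
      Function.update ![(x 0).2, (x 1).2, (x 2).2] 0 a = ![a, (x 1).2, (x 2).2] ∧
      Function.update ![(x 0).2, (x 1).2, (x 2).2] 1 a = ![(x 0).2, a, (x 2).2] ∧
      Function.update ![(x 0).2, (x 1).2, (x 2).2] 2 a = ![(x 0).2, (x 1).2, a] := fun a => by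
    refine ⟨?_, ?_, ?_⟩ <;> exact funext fun j => by fin_cases j <;> rfl
  simp only [GMap.bd, h]
  simp [e, u, GMap.op, Fin.sum_univ_succ, Finset.sum_filter, add_assoc]

@[simp]
theorem GMap.bd_four (f : GMap C D p 4) (x : Fin 4 → ℤ × C.Tot) :
    f.bd x = D.d (f.toMap ![(x 0).2, (x 1).2, (x 2).2, (x 3).2]) - p.negOnePow •
      (f.toMap ![C.d (x 0).2, (x 1).2, (x 2).2, (x 3).2] +
        ((x 0).1).negOnePow • f.toMap ![(x 0).2, C.d (x 1).2, (x 2).2, (x 3).2] +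
        ((x 0).1 + (x 1).1).negOnePow • f.toMap ![(x 0).2, (x 1).2, C.d (x 2).2, (x 3).2] +
        ((x 0).1 + (x 1).1 + (x 2).1).negOnePow •
          f.toMap ![(x 0).2, (x 1).2, (x 2).2, C.d (x 3).2]) := by
  have h : ∀ i, f.op (Function.update x i ((x i).1 - 1, C.d (x i).2)) =
      f.toMap (Function.update (fun j => (x j).2) i (C.d (x i).2)) := fun i =>
    congrArg f.toMap (funext fun j => by by_cases hj : j = i <;> [(subst hj; simp); simp [hj]])
  have e : (fun j => (x j).2) = ![(x 0).2, (x 1).2, (x 2).2, (x 3).2] :=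
    funext fun j => by fin_cases j <;> rfl
  have u : ∀ a,
      Function.update ![(x 0).2, (x 1).2, (x 2).2, (x 3).2] 0 a = ![a, (x 1).2, (x 2).2, (x 3).2] ∧
      Function.update ![(x 0).2, (x 1).2, (x 2).2, (x 3).2] 1 a = ![(x 0).2, a, (x 2).2, (x 3).2] ∧
      Function.update ![(x 0).2, (x 1).2, (x 2).2, (x 3).2] 2 a = ![(x 0).2, (x 1).2, a, (x 3).2] ∧
      Function.update ![(x 0).2, (x 1).2, (x 2).2, (x 3).2] 3 a =
        ![(x 0).2, (x 1).2, (x 2).2, a] := fun a => by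
    refine ⟨?_, ?_, ?_, ?_⟩ <;> exact funext fun j => by fin_cases j <;> rfl
  simp only [GMap.bd, h]
  simp [e, u, GMap.op, Fin.sum_univ_succ, Finset.sum_filter, add_assoc]

/-! ### Permutation actions and Koszul signs. -/

@[simp]
theorem Op.act_two_cyc_01 (f : Op C D p 2) (x : Fin 2 → ℤ × C.Tot) :
    f.act (cyc [0, 1]) x = koszulSign (cyc [0, 1]) (fun i => (x i).1) •
      f ![x 1, x 0] :=
  congrArg _ (congrArg f (funext fun i => by fin_cases i <;> exact congrArg x (by decide)))

@[simp]
theorem Op.act_three_cyc_01 (f : Op C D p 3) (x : Fin 3 → ℤ × C.Tot) :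
    f.act (cyc [0, 1]) x = koszulSign (cyc [0, 1]) (fun i => (x i).1) •
      f ![x 1, x 0, x 2] :=
  congrArg _ (congrArg f (funext fun i => by fin_cases i <;> exact congrArg x (by decide)))

@[simp]
theorem Op.act_three_cyc_12 (f : Op C D p 3) (x : Fin 3 → ℤ × C.Tot) :
    f.act (cyc [1, 2]) x = koszulSign (cyc [1, 2]) (fun i => (x i).1) •
      f ![x 0, x 2, x 1] :=
  congrArg _ (congrArg f (funext fun i => by fin_cases i <;> exact congrArg x (by decide)))

-- Slot `i` of the permuted tuple is read at `σ⁻¹ i`, so the cycle 0 ↦ 1 ↦ 2 ↦ 0 brings the last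
-- entry to the front. The other cycles follow the same pattern.
@[simp]
theorem Op.act_three_cyc_012 (f : Op C D p 3) (x : Fin 3 → ℤ × C.Tot) :
    f.act (cyc [0, 1, 2]) x = koszulSign (cyc [0, 1, 2]) (fun i => (x i).1) •
      f ![x 2, x 0, x 1] :=
  congrArg _ (congrArg f (funext fun i => by fin_cases i <;> exact congrArg x (by decide)))

@[simp]
theorem Op.act_three_cyc_021 (f : Op C D p 3) (x : Fin 3 → ℤ × C.Tot) :
    f.act (cyc [0, 2, 1]) x = koszulSign (cyc [0, 2, 1]) (fun i => (x i).1) •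
      f ![x 1, x 2, x 0] :=
  congrArg _ (congrArg f (funext fun i => by fin_cases i <;> exact congrArg x (by decide)))

@[simp]
theorem Op.act_four_cyc_01 (f : Op C D p 4) (x : Fin 4 → ℤ × C.Tot) :
    f.act (cyc [0, 1]) x = koszulSign (cyc [0, 1]) (fun i => (x i).1) •
      f ![x 1, x 0, x 2, x 3] :=
  congrArg _ (congrArg f (funext fun i => by fin_cases i <;> exact congrArg x (by decide)))

@[simp]
theorem Op.act_four_cyc_12 (f : Op C D p 4) (x : Fin 4 → ℤ × C.Tot) :
    f.act (cyc [1, 2]) x = koszulSign (cyc [1, 2]) (fun i => (x i).1) •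
      f ![x 0, x 2, x 1, x 3] :=
  congrArg _ (congrArg f (funext fun i => by fin_cases i <;> exact congrArg x (by decide)))

@[simp]
theorem Op.act_four_cyc_23 (f : Op C D p 4) (x : Fin 4 → ℤ × C.Tot) :
    f.act (cyc [2, 3]) x = koszulSign (cyc [2, 3]) (fun i => (x i).1) •
      f ![x 0, x 1, x 3, x 2] :=
  congrArg _ (congrArg f (funext fun i => by fin_cases i <;> exact congrArg x (by decide)))

@[simp]
theorem Op.act_four_cyc_012 (f : Op C D p 4) (x : Fin 4 → ℤ × C.Tot) :
    f.act (cyc [0, 1, 2]) x = koszulSign (cyc [0, 1, 2]) (fun i => (x i).1) •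
      f ![x 2, x 0, x 1, x 3] :=
  congrArg _ (congrArg f (funext fun i => by fin_cases i <;> exact congrArg x (by decide)))

@[simp]
theorem Op.act_four_cyc_021 (f : Op C D p 4) (x : Fin 4 → ℤ × C.Tot) :
    f.act (cyc [0, 2, 1]) x = koszulSign (cyc [0, 2, 1]) (fun i => (x i).1) •
      f ![x 1, x 2, x 0, x 3] :=
  congrArg _ (congrArg f (funext fun i => by fin_cases i <;> exact congrArg x (by decide)))

@[simp]
theorem Op.act_five_cyc_01 (f : Op C D p 5) (x : Fin 5 → ℤ × C.Tot) :
    f.act (cyc [0, 1]) x = koszulSign (cyc [0, 1]) (fun i => (x i).1) •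
      f ![x 1, x 0, x 2, x 3, x 4] :=
  congrArg _ (congrArg f (funext fun i => by fin_cases i <;> exact congrArg x (by decide)))

@[simp]
theorem Op.act_five_cyc_12 (f : Op C D p 5) (x : Fin 5 → ℤ × C.Tot) :
    f.act (cyc [1, 2]) x = koszulSign (cyc [1, 2]) (fun i => (x i).1) •
      f ![x 0, x 2, x 1, x 3, x 4] :=
  congrArg _ (congrArg f (funext fun i => by fin_cases i <;> exact congrArg x (by decide)))

@[simp]
theorem Op.act_five_cyc_23 (f : Op C D p 5) (x : Fin 5 → ℤ × C.Tot) :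
    f.act (cyc [2, 3]) x = koszulSign (cyc [2, 3]) (fun i => (x i).1) •
      f ![x 0, x 1, x 3, x 2, x 4] :=
  congrArg _ (congrArg f (funext fun i => by fin_cases i <;> exact congrArg x (by decide)))

@[simp]
theorem Op.act_five_cyc_012 (f : Op C D p 5) (x : Fin 5 → ℤ × C.Tot) :
    f.act (cyc [0, 1, 2]) x = koszulSign (cyc [0, 1, 2]) (fun i => (x i).1) •
      f ![x 2, x 0, x 1, x 3, x 4] :=
  congrArg _ (congrArg f (funext fun i => by fin_cases i <;> exact congrArg x (by decide)))

@[simp]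
theorem Op.act_five_cyc_021 (f : Op C D p 5) (x : Fin 5 → ℤ × C.Tot) :
    f.act (cyc [0, 2, 1]) x = koszulSign (cyc [0, 2, 1]) (fun i => (x i).1) •
      f ![x 1, x 2, x 0, x 3, x 4] :=
  congrArg _ (congrArg f (funext fun i => by fin_cases i <;> exact congrArg x (by decide)))

@[simp]
theorem Op.act_five_cyc_123 (f : Op C D p 5) (x : Fin 5 → ℤ × C.Tot) :
    f.act (cyc [1, 2, 3]) x = koszulSign (cyc [1, 2, 3]) (fun i => (x i).1) •
      f ![x 0, x 3, x 1, x 2, x 4] :=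
  congrArg _ (congrArg f (funext fun i => by fin_cases i <;> exact congrArg x (by decide)))

@[simp]
theorem Op.act_five_cyc_132 (f : Op C D p 5) (x : Fin 5 → ℤ × C.Tot) :
    f.act (cyc [1, 3, 2]) x = koszulSign (cyc [1, 3, 2]) (fun i => (x i).1) •
      f ![x 0, x 2, x 3, x 1, x 4] :=
  congrArg _ (congrArg f (funext fun i => by fin_cases i <;> exact congrArg x (by decide)))

@[simp]
theorem Op.act_five_cyc_0123 (f : Op C D p 5) (x : Fin 5 → ℤ × C.Tot) :
    f.act (cyc [0, 1, 2, 3]) x = koszulSign (cyc [0, 1, 2, 3]) (fun i => (x i).1) •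
      f ![x 3, x 0, x 1, x 2, x 4] :=
  congrArg _ (congrArg f (funext fun i => by fin_cases i <;> exact congrArg x (by decide)))

@[simp]
theorem Op.act_five_cyc_0231 (f : Op C D p 5) (x : Fin 5 → ℤ × C.Tot) :
    f.act (cyc [0, 2, 3, 1]) x = koszulSign (cyc [0, 2, 3, 1]) (fun i => (x i).1) •
      f ![x 1, x 3, x 0, x 2, x 4] :=
  congrArg _ (congrArg f (funext fun i => by fin_cases i <;> exact congrArg x (by decide)))

@[simp]
theorem Op.act_five_cyc_0321 (f : Op C D p 5) (x : Fin 5 → ℤ × C.Tot) :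
    f.act (cyc [0, 3, 2, 1]) x = koszulSign (cyc [0, 3, 2, 1]) (fun i => (x i).1) •
      f ![x 1, x 2, x 3, x 0, x 4] :=
  congrArg _ (congrArg f (funext fun i => by fin_cases i <;> exact congrArg x (by decide)))

@[simp]
theorem Op.act_five_cyc_02_13 (f : Op C D p 5) (x : Fin 5 → ℤ × C.Tot) :
    f.act (cyc [0, 2] * cyc [1, 3]) x = koszulSign (cyc [0, 2] * cyc [1, 3]) (fun i => (x i).1) •
      f ![x 2, x 3, x 0, x 1, x 4] :=
  congrArg _ (congrArg f (funext fun i => by fin_cases i <;> exact congrArg x (by decide)))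

/-- A sign can only arise from two arguments of nonzero degree. The relations below reduce to tuples
with at most one such argument, as elements of nonzero degree have no Hamiltonian field. -/
theorem koszulSign_eq_one {n : ℕ} (σ : Equiv.Perm (Fin n)) (e : Fin n → ℤ)
    (h : ∀ i j, i < j → e i * e j = 0) : koszulSign σ e = 1 :=
  Finset.prod_eq_one fun i _ => Finset.prod_eq_one fun j _ => by
    split_ifs with hij
    · rw [h i j hij.1, Int.negOnePow_zero]
    · rfl

theorem koszulSign_two (σ : Equiv.Perm (Fin 2)) (e : Fin 2 → ℤ) (h : e 0 * e 1 = 0) :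
    koszulSign σ e = 1 :=
  koszulSign_eq_one σ e fun i j hij => by
    fin_cases i <;> fin_cases j <;> simp_all

theorem koszulSign_three (σ : Equiv.Perm (Fin 3)) (e : Fin 3 → ℤ) (h₁ : e 0 * e 1 = 0)
    (h₂ : e 0 * e 2 = 0) (h₃ : e 1 * e 2 = 0) : koszulSign σ e = 1 :=
  koszulSign_eq_one σ e fun i j hij => by
    fin_cases i <;> fin_cases j <;> first | assumption | exact absurd hij (by decide)

theorem koszulSign_four (σ : Equiv.Perm (Fin 4)) (e : Fin 4 → ℤ) (h₁ : e 0 * e 1 = 0)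
    (h₂ : e 0 * e 2 = 0) (h₃ : e 0 * e 3 = 0) (h₄ : e 1 * e 2 = 0) (h₅ : e 1 * e 3 = 0)
    (h₆ : e 2 * e 3 = 0) : koszulSign σ e = 1 :=
  koszulSign_eq_one σ e fun i j hij => by
    fin_cases i <;> fin_cases j <;> first | assumption | exact absurd hij (by decide)

theorem koszulSign_five (σ : Equiv.Perm (Fin 5)) (e : Fin 5 → ℤ) (h₁ : e 0 * e 1 = 0)
    (h₂ : e 0 * e 2 = 0) (h₃ : e 0 * e 3 = 0) (h₄ : e 0 * e 4 = 0) (h₅ : e 1 * e 2 = 0)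
    (h₆ : e 1 * e 3 = 0) (h₇ : e 1 * e 4 = 0) (h₈ : e 2 * e 3 = 0) (h₉ : e 2 * e 4 = 0)
    (h₁₀ : e 3 * e 4 = 0) : koszulSign σ e = 1 :=
  koszulSign_eq_one σ e fun i j hij => by
    fin_cases i <;> fin_cases j <;> first | assumption | exact absurd hij (by decide)

@[simp]
theorem GMap.comp1_apply (h : GMap D F p 1) (g : GMap C D q n) (x : Fin n → ℤ × C.Tot) :
    h.comp1 g x = h.toMap ![g.toMap fun i => (x i).2] :=
  congrArg h.toMap (funext fun j => by fin_cases j; rfl)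

@[simp]
theorem GMap.op_apply (f : GMap C D p n) (x : Fin n → ℤ × C.Tot) :
    f.op x = f.toMap fun i => (x i).2 := rfl

@[simp]
theorem negOnePow_two : (2 : ℤ).negOnePow = 1 := rfl

end Evaluation

/-! ### Abstract Cartan calculus and its consequences. -/

section CartanCalculus

variable {R : Type u} [CommRing R]

/-- An abstract Cartan calculus on a three-term complex: `ι a b` is the contraction of `b` with
the Hamiltonian vector field of `a`, and `lam a b` is the contraction of the closed form with the
Hamiltonian vector fields of `a` and `b`. -/
structure CartanCalculus (C : ThreeTermComplex.{u, v} R) where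
  ι : C.Tot →ₗ[R] C.Tot →ₗ[R] C.Tot
  lam : C.Tot →ₗ[R] C.Tot →ₗ[R] C.Tot
  ι_mem : ∀ (a b : C.Tot) (q : ℤ), b ∈ C.gr q → ι a b ∈ C.gr (q + 1)
  lam_mem : ∀ a b : C.Tot, lam a b ∈ C.gr 0
  ι_eq_zero : ∀ a : C.Tot, a.1 = 0 → ι a = 0
  lam_eq_zero : ∀ a : C.Tot, a.1 = 0 → lam a = 0
  ι_d : ∀ a : C.Tot, ι (C.d a) = 0
  lam_d : ∀ a : C.Tot, lam (C.d a) = 0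
  ι_fst : ∀ a b : C.Tot, (ι a b).1 = 0
  ι_ι : ∀ a b c : C.Tot, ι a (ι b c) = -ι b (ι a c)
  -- Each contraction raises the degree by one, so three of them leave the range 0, 1, 2.
  ι_ι_ι : ∀ a b c e : C.Tot, ι a (ι b (ι c e)) = 0
  lam_symm : ∀ a b : C.Tot, lam a b = -lam b a
  ι_lam : ∀ a b c : C.Tot, ι a (lam b c) = -ι b (lam a c)
  -- The rule L_a ι_b = ι_b L_a + ι_[a,b], with `lam a b` in place of the bracket of fields. On the
  -- left no `lam` term is needed because `ι b c` has no component of degree 0.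
  lie_ι : ∀ a b c : C.Tot,
    C.d (ι a (ι b c)) + ι a (C.d (ι b c)) =
      ι b (C.d (ι a c)) + ι b (ι a (C.d c)) + ι b (lam a c) + ι (lam a b) c
  -- The derivation rule of L_a on `lam b c`; the term `ι a (d (lam b c))` is absent because `lam b
  -- c` has degree 0, where the differential of the complex vanishes.
  lie_lam : ∀ a b c : C.Tot,
    C.d (ι a (lam b c)) + lam a (lam b c) = lam (lam a b) c + lam b (lam a c)

namespace CartanCalculus

variable {C : ThreeTermComplex.{u, v} R} (K : CartanCalculus C)

@[simp]
theorem _root_.ThreePlectic.ThreeTermComplex.d_d (x : C.Tot) : C.d (C.d x) = 0 := by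
  have h := LinearMap.congr_fun C.d1_comp_d2 x.2.2
  simp only [LinearMap.comp_apply, LinearMap.zero_apply] at h
  simp [ThreeTermComplex.d, h]

theorem _root_.ThreePlectic.ThreeTermComplex.d_mem {x : C.Tot} {q : ℤ} (hx : x ∈ C.gr q) :
    C.d x ∈ C.gr (q - 1) := by
  obtain ⟨-, h1, h2⟩ := hx
  refine ⟨fun h => ?_, fun h => ?_, fun h => rfl⟩
  · simp [ThreeTermComplex.d, h1 (by omega)]
  · simp [ThreeTermComplex.d, h2 (by omega)]

attribute [simp] ι_d lam_d

@[simp]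
theorem d_lam (a b : C.Tot) : C.d (K.lam a b) = 0 := by
  obtain ⟨-, h1, h2⟩ := K.lam_mem a b
  simp [ThreeTermComplex.d, h1 (by simp), h2 (by simp)]

@[simp]
theorem ι_ι_left (a b : C.Tot) : K.ι (K.ι a b) = 0 := K.ι_eq_zero _ (K.ι_fst a b)

@[simp]
theorem lam_ι_left (a b : C.Tot) : K.lam (K.ι a b) = 0 := K.lam_eq_zero _ (K.ι_fst a b)

theorem lam_right_eq_zero (a : C.Tot) {b : C.Tot} (h : b.1 = 0) : K.lam a b = 0 := by
  rw [K.lam_symm, K.lam_eq_zero b h]; simp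

@[simp]
theorem lam_ι_right (a b c : C.Tot) : K.lam a (K.ι b c) = 0 :=
  K.lam_right_eq_zero a (K.ι_fst b c)

@[simp]
theorem lam_d_right (a b : C.Tot) : K.lam a (C.d b) = 0 := by
  rw [K.lam_symm, K.lam_d]; simp

/-- The Lie derivative of `b` along the Hamiltonian vector field of `a`. -/
def lie : C.Tot →ₗ[R] C.Tot →ₗ[R] C.Tot :=
  -- The summand `lam` repairs the truncation: on a Hamiltonian 2-form b, where `C.d` gives 0, the
  -- true term is ι_a db = -ι_a ι_b ω = ι_b ι_a ω.
  K.ι.compr₂ C.d + K.ι.compl₂ C.d + K.lam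

theorem lie_apply (a b : C.Tot) :
    K.lie a b = C.d (K.ι a b) + K.ι a (C.d b) + K.lam a b := rfl

theorem lie_mem {b : C.Tot} (a : C.Tot) {q : ℤ} (hb : b ∈ C.gr q) : K.lie a b ∈ C.gr q := by
  refine add_mem (add_mem ?_ ?_) ?_
  · simpa using ThreeTermComplex.d_mem (K.ι_mem a b q hb)
  · simpa using K.ι_mem a _ _ (ThreeTermComplex.d_mem hb)
  · by_cases hq : q = 0
    · subst hq; exact K.lam_mem a b
    · rw [K.lam_right_eq_zero a (hb.1 hq)]
      exact zero_mem _

-- The Lie derivative differs from `lam` by an exact element and a contraction, and neither has a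
-- Hamiltonian field.
@[simp]
theorem ι_lie_left (a b : C.Tot) : K.ι (K.lie a b) = K.ι (K.lam a b) := by
  rw [lie_apply, map_add, map_add, K.ι_d, K.ι_ι_left, zero_add, zero_add]

@[simp]
theorem lam_lie_left (a b : C.Tot) : K.lam (K.lie a b) = K.lam (K.lam a b) := by
  rw [lie_apply, map_add, map_add, K.lam_d, K.lam_ι_left, zero_add, zero_add]

theorem mem_gr_zero_or {a : C.Tot} {p : ℤ} (h : a ∈ C.gr p) : p = 0 ∨ a.1 = 0 := by
  by_cases hp : p = 0
  · exact .inl hp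
  · exact .inr (h.1 hp)

theorem lie_eq_zero {a : C.Tot} (h : a.1 = 0) : K.lie a = 0 :=
  LinearMap.ext fun b => by simp [lie_apply, K.ι_eq_zero a h, K.lam_eq_zero a h]

@[simp]
theorem lie_d_left (a : C.Tot) : K.lie (C.d a) = 0 :=
  LinearMap.ext fun b => by simp [lie_apply, K.ι_d, K.lam_d]

@[simp]
theorem lie_ι_left (a b : C.Tot) : K.lie (K.ι a b) = 0 := K.lie_eq_zero (K.ι_fst a b)

@[simp]
theorem lie_lie_left (a b : C.Tot) : K.lie (K.lie a b) = K.lie (K.lam a b) :=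
  LinearMap.ext fun c => by simp [lie_apply K (K.lie a b), lie_apply K (K.lam a b)]

/-- The homotopy formula for the Lie derivative. -/
@[simp]
theorem d_ι (a b : C.Tot) : C.d (K.ι a b) = K.lie a b - K.ι a (C.d b) - K.lam a b := by
  rw [lie_apply]; abel

-- By d² = 0 both sides reduce to d ι_a d b: the correction `lam` takes closed values and vanishes
-- on exact elements.
@[simp]
theorem d_lie (a b : C.Tot) : C.d (K.lie a b) = K.lie a (C.d b) := by
  rw [lie_apply K a (C.d b)]
  simp only [lie_apply K a b, map_add, ThreeTermComplex.d_d, d_lam, lam_d_right, map_zero]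
  abel

@[simp]
theorem lie_ι_right (a b c : C.Tot) :
    K.lie a (K.ι b c) = K.ι b (K.lie a c) + K.ι (K.lam a b) c := by
  rw [lie_apply, lam_ι_right, add_zero, K.lie_ι, lie_apply, map_add, map_add]

@[simp]
theorem lie_lam_right (a b c : C.Tot) :
    K.lie a (K.lam b c) = K.lam (K.lam a b) c + K.lam b (K.lam a c) := by
  rw [lie_apply, d_lam, map_zero, add_zero, K.lie_lam]

@[simp]
theorem lam_lie_right (a b c : C.Tot) : K.lam a (K.lie b c) = K.lam a (K.lam b c) := by
  rw [lie_apply, map_add, map_add, lam_d_right, lam_ι_right, zero_add, zero_add]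

/-- Apply d to the commutator rule for L_a and ι_b. Since d commutes with L_a and turns contractions
into Lie derivatives by the homotopy formula, this yields [L_a, L_b] = L_[a,b]; the remaining terms
cancel by the commutator rules for `ι b (d c)` and `lam b c`. -/
theorem lie_lie (a b c : C.Tot) :
    K.lie a (K.lie b c) = K.lie b (K.lie a c) + K.lie (K.lam a b) c := by
  have h := congrArg C.d (K.lie_ι_right a b c)
  rw [d_lie, d_ι, map_add, d_ι, d_ι, map_sub, map_sub, lie_ι_right, lie_lam_right, d_lie] at h
  rw [← sub_eq_zero] at h ⊢
  rw [← h]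
  rw [lam_lie_right]
  abel

/-- The two transpositions given by `ι_lam` and `lam_symm` generate the symmetric group, so ω(v_b,
v_c, v_a, ⋅) is totally antisymmetric. This and the next lemmas serve to sort its arguments. -/
theorem ι_lam' (a b c : C.Tot) : K.ι a (K.lam b c) = -K.ι c (K.lam b a) := by
  rw [K.ι_lam a b c, K.lam_symm a c, map_neg, neg_neg, K.ι_lam b c a]

theorem lam_lam (a b c : C.Tot) : K.lam (K.lam a b) c = K.lam c (K.lam b a) := by
  rw [K.lam_symm (K.lam a b) c, K.lam_symm a b, map_neg, neg_neg]

theorem ι_lam_cyc (a b c : C.Tot) : K.ι a (K.lam b c) = K.ι c (K.lam a b) := by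
  rw [K.ι_lam' a b c, K.lam_symm b a, map_neg, neg_neg]

/-- A triple contraction vanishes for degree reasons, so the homotopy formula for it has left side
0. Expanding the right side inwards leaves this relation between double contractions, which is the
core of the arity four equation for a morphism. -/
theorem cartan_three (a b c e : C.Tot) :
    K.ι b (K.ι c (K.lie a e)) + K.ι b (K.ι (K.lam a c) e) + K.ι (K.lam a b) (K.ι c e)
      - K.ι a (K.ι c (K.lie b e)) - K.ι a (K.ι (K.lam b c) e) + K.ι a (K.ι b (K.lie c e)) =
    K.ι a (K.ι b (K.lam c e)) := by
  have h := K.d_ι a (K.ι b (K.ι c e))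
  rw [ι_ι_ι, map_zero] at h
  simp only [d_ι, lie_ι_right, lam_ι_right, map_sub, map_add, sub_zero, ι_ι_ι] at h
  rw [← sub_eq_zero, h]
  abel

/-- The differential of the contraction of the closed form with four Hamiltonian vector fields. -/
theorem d_ι_ι_lam (a b c e : C.Tot) :
    C.d (K.ι e (K.ι c (K.lam a b))) =
      -(K.ι e (K.lam (K.lam a b) c) - K.ι e (K.lam a (K.lam b c)) + K.ι e (K.lam b (K.lam a c))
        + K.ι (K.lam c e) (K.lam a b) - K.ι (K.lam b e) (K.lam a c)
        + K.ι (K.lam a e) (K.lam b c)) := by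
  -- The homotopy formula is used twice, down to the closed element `lam a b`. The rewrites below
  -- only bring the resulting terms into the order of the statement.
  simp only [d_ι, lie_ι_right, lie_lam_right, d_lam, lam_ι_right, map_sub, map_add, map_zero,
    sub_zero]
  rw [K.lam_lam c a b, K.lam_symm c b, K.lam_lam a b c, K.lam_symm b a,
    K.lam_lam e a b, K.lam_symm e b, K.lam_symm e c,
    K.ι_lam' c b (K.lam a e), K.lam_symm b c]
  simp only [map_neg, LinearMap.neg_apply]
  rw [K.ι_lam' c a (K.lam b e)]
  abel

/-- The Chevalley–Eilenberg cocycle property of the closed form. -/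
theorem cocycle (a b c d e : C.Tot) :
    K.ι e (K.ι d (K.lam (K.lam a b) c)) - K.ι e (K.ι d (K.lam a (K.lam b c)))
      + K.ι e (K.ι d (K.lam b (K.lam a c))) + K.ι e (K.ι (K.lam c d) (K.lam a b))
      - K.ι e (K.ι (K.lam b d) (K.lam a c)) + K.ι e (K.ι (K.lam a d) (K.lam b c)) =
    K.ι (K.lam d e) (K.ι c (K.lam a b)) - K.ι (K.lam c e) (K.ι d (K.lam a b))
      + K.ι (K.lam b e) (K.ι d (K.lam a c)) - K.ι (K.lam a e) (K.ι d (K.lam b c)) := by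
  -- The element ι_d ι_c λ₂(a,b) sits in top degree, so L_e acts on it as ι_e d alone. Computing L_e
  -- by the commutator rules and d by `d_ι_ι_lam` gives the two sides.
  have h := K.lie_apply e (K.ι d (K.ι c (K.lam a b)))
  rw [d_ι_ι_lam, ι_ι_ι, lam_ι_right] at h
  simp only [lie_ι_right, lie_lam_right, map_add, map_sub, map_neg, map_zero, zero_add,
    add_zero] at h
  rw [K.lam_lam e a b, K.lam_symm e b, K.lam_symm e c, K.lam_symm e d,
    K.ι_lam' c b (K.lam a e)] at h
  simp only [map_neg, LinearMap.neg_apply] at h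
  rw [K.ι_lam' c a (K.lam b e), map_neg, K.ι_ι d (K.lam a e), K.ι_ι d (K.lam b e),
    K.ι_ι d (K.lam c e)] at h
  rw [eq_comm, neg_eq_iff_eq_neg] at h
  rw [h]
  abel

/-- Elements on which the contraction vanishes contribute nothing to the structure maps. -/
theorem split {x : ℤ × C.Tot} (h : x.2 ∈ C.gr x.1) :
    x.1 = 0 ∨ (K.ι x.2 = 0 ∧ K.lam x.2 = 0 ∧ (∀ b, K.lam b x.2 = 0) ∧ K.lie x.2 = 0) := by
  refine (mem_gr_zero_or h).imp_right fun hx => ⟨K.ι_eq_zero _ hx, K.lam_eq_zero _ hx,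
    fun b => K.lam_right_eq_zero b hx, K.lie_eq_zero hx⟩

/-! ### Graded multilinear maps -/

/-- The zero operation. -/
def zeroMap (C : ThreeTermComplex.{u, v} R) (p : ℤ) (n : ℕ) : GMap C C p n where
  toMap := 0
  mem_gr _ _ _ := zero_mem _

/-- The identity. -/
def idMap (C : ThreeTermComplex.{u, v} R) : GMap C C 0 1 where
  toMap := MultilinearMap.mk' (fun x => x 0)
    (by intro x i a b; fin_cases i; simp)
    (by intro x i c a; fin_cases i; simp)
  mem_gr e x h := by simpa using h 0

/-- The graded bilinear map given by a bilinear map. -/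
def ofBilin (p : ℤ) (f : C.Tot →ₗ[R] C.Tot →ₗ[R] C.Tot)
    (h : ∀ a b p₁ p₂, a ∈ C.gr p₁ → b ∈ C.gr p₂ → f a b ∈ C.gr (p + (p₁ + p₂))) :
    GMap C C p 2 where
  toMap := MultilinearMap.mk' (fun x => f (x 0) (x 1))
    (by intro x i a b; fin_cases i <;> simp)
    (by intro x i c a; fin_cases i <;> simp)
  mem_gr e x hx := by
    rw [Fin.sum_univ_two]
    exact h _ _ _ _ (hx 0) (hx 1)

/-- Homogeneity in the first variable is free: either p = 0, or the field of `a` vanishes and so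
does the value. -/
theorem ι_mem' {a b : C.Tot} {p q : ℤ} (ha : a ∈ C.gr p) (hb : b ∈ C.gr q) :
    K.ι a b ∈ C.gr (1 + (p + q)) := by
  obtain rfl | h := mem_gr_zero_or ha
  · simpa [add_comm] using K.ι_mem a b q hb
  · rw [K.ι_eq_zero _ h]; exact zero_mem _

theorem lam_mem' {a b : C.Tot} {p q : ℤ} (ha : a ∈ C.gr p) (hb : b ∈ C.gr q) :
    K.lam a b ∈ C.gr (0 + (p + q)) := by
  obtain rfl | h := mem_gr_zero_or ha
  · obtain rfl | h := mem_gr_zero_or hb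
    · exact K.lam_mem a b
    · rw [K.lam_right_eq_zero _ h]; exact zero_mem _
  · rw [K.lam_eq_zero _ h]; exact zero_mem _

theorem lie_mem' {a b : C.Tot} {p q : ℤ} (ha : a ∈ C.gr p) (hb : b ∈ C.gr q) :
    K.lie a b ∈ C.gr (0 + (p + q)) := by
  obtain rfl | h := mem_gr_zero_or ha
  · simpa using K.lie_mem a hb
  · rw [lie_apply, K.ι_eq_zero _ h, K.lam_eq_zero _ h]; simp

def lamMap : GMap C C 0 2 := ofBilin 0 K.lam fun _ _ _ _ => K.lam_mem'

def lieMap : GMap C C 0 2 := ofBilin 0 K.lie fun _ _ _ _ => K.lie_mem'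

def ιMap : GMap C C 1 2 := ofBilin 1 K.ι fun _ _ _ _ => K.ι_mem'

def negιMap : GMap C C 1 2 := ofBilin 1 (-K.ι) fun _ _ _ _ ha hb => neg_mem (K.ι_mem' ha hb)

def altMap : GMap C C 1 2 := ofBilin 1 (K.ι + K.ι.flip) fun _ _ p₁ p₂ ha hb =>
  add_mem (K.ι_mem' ha hb) (add_comm p₁ p₂ ▸ K.ι_mem' hb ha)

/-- The contraction of the closed form with three Hamiltonian vector fields, with a sign. -/
def lamMap3 : GMap C C 1 3 where
  toMap := -MultilinearMap.mk' (fun x => K.ι (x 2) (K.lam (x 0) (x 1)))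
    (by intro x i a b; fin_cases i <;> simp)
    (by intro x i c a; fin_cases i <;> simp)
  mem_gr e x hx := by
    rw [show 1 + ∑ i, e i = 1 + (e 2 + (0 + (e 0 + e 1))) by rw [Fin.sum_univ_three]; ring]
    exact neg_mem (K.ι_mem' (hx 2) (K.lam_mem' (hx 0) (hx 1)))

/-- The contraction of the closed form with four Hamiltonian vector fields, with a sign. -/
def lamMap4 : GMap C C 2 4 where
  toMap := -MultilinearMap.mk' (fun x => K.ι (x 3) (K.ι (x 2) (K.lam (x 0) (x 1))))
    (by intro x i a b; fin_cases i <;> simp)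
    (by intro x i c a; fin_cases i <;> simp)
  mem_gr e x hx := by
    rw [show 2 + ∑ i, e i = 1 + (e 3 + (1 + (e 2 + (0 + (e 0 + e 1))))) by
      rw [Fin.sum_univ_four]; ring]
    exact neg_mem (K.ι_mem' (hx 3) (K.ι_mem' (hx 2) (K.lam_mem' (hx 0) (hx 1))))

/-- The double contraction. -/
def ιMap3 : GMap C C 2 3 where
  toMap := MultilinearMap.mk' (fun x => K.ι (x 0) (K.ι (x 1) (x 2)))
    (by intro x i a b; fin_cases i <;> simp)
    (by intro x i c a; fin_cases i <;> simp)
  mem_gr e x hx := by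
    rw [show 2 + ∑ i, e i = 1 + (e 0 + (1 + (e 1 + e 2))) by rw [Fin.sum_univ_three]; ring]
    exact K.ι_mem' (hx 0) (K.ι_mem' (hx 1) (hx 2))

/-- The double contraction, with a sign. -/
def negιMap3 : GMap C C 2 3 where
  toMap := -MultilinearMap.mk' (fun x => K.ι (x 1) (K.ι (x 0) (x 2)))
    (by intro x i a b; fin_cases i <;> simp)
    (by intro x i c a; fin_cases i <;> simp)
  mem_gr e x hx := by
    rw [show 2 + ∑ i, e i = 1 + (e 1 + (1 + (e 0 + e 2))) by rw [Fin.sum_univ_three]; ring]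
    exact neg_mem (K.ι_mem' (hx 1) (K.ι_mem' (hx 0) (hx 2)))

@[simp]
theorem zeroMap_toMap (p : ℤ) (n : ℕ) (x) : (zeroMap C p n).toMap x = 0 := rfl
@[simp]
theorem idMap_toMap (x) : (idMap C).toMap x = x 0 := rfl
@[simp]
theorem lamMap_toMap (x) : K.lamMap.toMap x = K.lam (x 0) (x 1) := rfl
@[simp]
theorem lieMap_toMap (x) : K.lieMap.toMap x = K.lie (x 0) (x 1) := rfl
@[simp]
theorem ιMap_toMap (x) : K.ιMap.toMap x = K.ι (x 0) (x 1) := rfl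
@[simp]
theorem negιMap_toMap (x) : K.negιMap.toMap x = -K.ι (x 0) (x 1) := rfl
@[simp]
theorem altMap_toMap (x) : K.altMap.toMap x = K.ι (x 0) (x 1) + K.ι (x 1) (x 0) := rfl
@[simp]
theorem lamMap3_toMap (x) : K.lamMap3.toMap x = -K.ι (x 2) (K.lam (x 0) (x 1)) := rfl
@[simp]
theorem lamMap4_toMap (x) :
    K.lamMap4.toMap x = -K.ι (x 3) (K.ι (x 2) (K.lam (x 0) (x 1))) := rfl
@[simp]
theorem ιMap3_toMap (x) : K.ιMap3.toMap x = K.ι (x 0) (K.ι (x 1) (x 2)) := rfl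
@[simp]
theorem negιMap3_toMap (x) : K.negιMap3.toMap x = -K.ι (x 1) (K.ι (x 0) (x 2)) := rfl

end CartanCalculus
end CartanCalculus

/-! ### The two weak Lie 3-algebras. -/

namespace CartanCalculus
variable {R : Type u} [CommRing R] {C : ThreeTermComplex.{u, v} R} (K : CartanCalculus C)
set_option maxHeartbeats 1000000 in
/-- The weak Lie 3-algebra whose structure maps are contractions of the closed form. -/
def lInfinity : WeakLie3Algebra C where
  l2 := K.lamMap
  l21 := zeroMap C 1 2
  l211 := zeroMap C 2 2
  l3 := K.lamMap3
  l31 := zeroMap C 2 3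
  l32 := zeroMap C 2 3
  l4 := K.lamMap4
  leib2 x hx := by
    simp
  leib3 x hx := by
    -- Except for the last argument, one of nonzero degree makes every term vanish, so only degree 0
    -- survives, with all signs trivial. The Leibniz relations never move the last argument, hence
    -- its degree is not split.
    obtain h0 | ⟨h0, h0', h0''⟩ := K.split (hx 0) <;>
    obtain h1 | ⟨h1, h1', h1''⟩ := K.split (hx 1) <;>
    simp [*, koszulSign_three]
    generalize (x 0).2 = a, (x 1).2 = b, (x 2).2 = c
    rw [K.lam_symm c (K.lam a b), K.lam_lam c a b, K.lam_symm c b, map_neg]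
    abel
  leib4 x hx := by
    obtain h0 | ⟨h0, h0', h0''⟩ := K.split (hx 0) <;>
    obtain h1 | ⟨h1, h1', h1''⟩ := K.split (hx 1) <;>
    obtain h2 | ⟨h2, h2', h2''⟩ := K.split (hx 2) <;>
    clear hx <;>
    -- The general formula `d_ι` is switched off so that the differential of λ₄ is rewritten at once
    -- into its sorted form.
    simp [*, koszulSign_four, d_ι_ι_lam, -d_ι]
    generalize (x 0).2 = a, (x 1).2 = b, (x 2).2 = c, (x 3).2 = e
    abel
  leib5 x hx := by
    simp
    obtain h0 | ⟨h0, h0', h0''⟩ := K.split (hx 0) <;>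
    obtain h1 | ⟨h1, h1', h1''⟩ := K.split (hx 1) <;>
    obtain h2 | ⟨h2, h2', h2''⟩ := K.split (hx 2) <;>
    obtain h3 | ⟨h3, h3', h3''⟩ := K.split (hx 3) <;>
    clear hx <;>
    simp [*, koszulSign_five]
    -- Values of λ₃ and λ₄ have positive degree, so the terms inserting them into λ₂ or λ₃ vanish.
    -- The ten terms in which λ₂ is inserted into λ₄ remain.
    have h := K.cocycle (x 0).2 (x 1).2 (x 2).2 (x 3).2 (x 4).2
    rw [← sub_eq_zero] at h
    rw [eq_comm, ← neg_eq_zero, ← h]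
    abel
  bd_l21 x hx := by
    obtain h0 | ⟨h0, h0', h0''⟩ := K.split (hx 0) <;>
    simp [*, koszulSign_two]
    rw [K.lam_symm (x 1).2, add_neg_cancel]
  bd_l211 x hx := by simp
  bd_l31 x hx := by
    obtain h0 | ⟨h0, h0', h0''⟩ := K.split (hx 0) <;>
    obtain h1 | ⟨h1, h1', h1''⟩ := K.split (hx 1) <;>
    simp [*, koszulSign_three]
    rw [K.lam_symm (x 1).2, map_neg, neg_neg, neg_add_cancel]
  bd_l32 x hx := by
    obtain h0 | ⟨h0, h0', h0''⟩ := K.split (hx 0) <;>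
    obtain h1 | ⟨h1, h1', h1''⟩ := K.split (hx 1) <;>
    obtain h2 | ⟨h2, h2', h2''⟩ := K.split (hx 2) <;>
    simp [*, koszulSign_three]
    rw [K.ι_lam' (x 1).2, neg_neg, neg_add_cancel]
  sym_l211 x hx := by simp
  sym_l31 x hx := by simp
  sym_l31_l32 x hx := by simp
  sym_l32 x hx := by simp
  sym_l4_12 x hx := by
    obtain h0 | ⟨h0, h0', h0''⟩ := K.split (hx 0) <;>
    obtain h1 | ⟨h1, h1', h1''⟩ := K.split (hx 1) <;>
    obtain h2 | ⟨h2, h2', h2''⟩ := K.split (hx 2) <;>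
    simp [*, koszulSign_four]
    rw [K.lam_symm (x 1).2]
    simp
  sym_l4_23 x hx := by
    obtain h0 | ⟨h0, h0', h0''⟩ := K.split (hx 0) <;>
    obtain h1 | ⟨h1, h1', h1''⟩ := K.split (hx 1) <;>
    obtain h2 | ⟨h2, h2', h2''⟩ := K.split (hx 2) <;>
    simp [*, koszulSign_four]
    rw [K.ι_lam' (x 1).2]
    simp
  sym_l4_34 x hx := by
    obtain h0 | ⟨h0, h0', h0''⟩ := K.split (hx 0) <;>
    obtain h1 | ⟨h1, h1', h1''⟩ := K.split (hx 1) <;>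
    obtain h2 | ⟨h2, h2', h2''⟩ := K.split (hx 2) <;>
    simp [*, koszulSign_four]
    rw [K.ι_ι (x 3).2]
    simp

set_option maxHeartbeats 1000000 in
/-- The weak Lie 3-algebra given by the Lie derivative and its alternator. -/
def leib : WeakLie3Algebra C where
  l2 := K.lieMap
  l21 := K.altMap
  l211 := zeroMap C 2 2
  l3 := zeroMap C 1 3
  l31 := zeroMap C 2 3
  l32 := zeroMap C 2 3
  l4 := zeroMap C 2 4
  leib2 x hx := by
    obtain h0 | ⟨h0, h0', h0''⟩ := K.split (hx 0) <;>
    simp [*]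
  leib3 x hx := by
    obtain h0 | ⟨h0, h0', h0''⟩ := K.split (hx 0) <;>
    obtain h1 | ⟨h1, h1', h1''⟩ := K.split (hx 1) <;>
    simp [*, koszulSign_three]
    rw [K.lie_lie (x 0).2]
    abel
  leib4 x hx := by simp
  leib5 x hx := by simp
  bd_l21 x hx := by
    obtain h0 | ⟨h0, h0', h0''⟩ := K.split (hx 0) <;>
    obtain h1 | ⟨h1, h1', h1''⟩ := K.split (hx 1) <;>
    simp [*, koszulSign_two]
    -- The homotopy formula produces L_a b + L_b a together with the corrections `lam a b` and `lam
    -- b a`, which cancel.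
    rw [K.lam_symm (x 1).2]
    abel
  bd_l211 x hx := by
    obtain h0 | ⟨h0, h0', h0''⟩ := K.split (hx 0) <;>
    obtain h1 | ⟨h1, h1', h1''⟩ := K.split (hx 1) <;>
    simp [*, koszulSign_two, add_comm]
  bd_l31 x hx := by simp
  bd_l32 x hx := by
    obtain h0 | ⟨h0, h0', h0''⟩ := K.split (hx 0) <;>
    obtain h1 | ⟨h1, h1', h1''⟩ := K.split (hx 1) <;>
    obtain h2 | ⟨h2, h2', h2''⟩ := K.split (hx 2) <;>
    simp [*, koszulSign_three]
    abel
  sym_l211 x hx := by simp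
  sym_l31 x hx := by simp
  sym_l31_l32 x hx := by
    obtain h0 | ⟨h0, h0', h0''⟩ := K.split (hx 0) <;>
    obtain h1 | ⟨h1, h1', h1''⟩ := K.split (hx 1) <;>
    obtain h2 | ⟨h2, h2', h2''⟩ := K.split (hx 2) <;>
    simp [*, koszulSign_three]
    -- The surviving cases are all arguments in degree 0, or exactly one of nonzero degree. Each
    -- argument that gets contracted occurs under the other two contractions in both orders, so the
    -- terms cancel in pairs.
    · rw [K.ι_ι (x 0).2 (x 1).2, K.ι_ι (x 0).2 (x 2).2, K.ι_ι (x 1).2 (x 2).2]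
      abel
    · rw [K.ι_ι (x 0).2, neg_add_cancel]
    · rw [K.ι_ι (x 0).2, neg_add_cancel]
    · rw [K.ι_ι (x 2).2, neg_add_cancel]
  sym_l32 x hx := by simp
  sym_l4_12 x hx := by simp
  sym_l4_23 x hx := by simp
  sym_l4_34 x hx := by simp

end CartanCalculus

/-! ### The comparison morphism and its inverse. -/

namespace CartanCalculus
variable {R : Type u} [CommRing R] {C : ThreeTermComplex.{u, v} R} (K : CartanCalculus C)
set_option maxHeartbeats 1000000 in
/-- The comparison morphism. -/
def comparison : WeakMorphism K.lInfinity K.leib where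
  f1 := idMap C
  f2 := K.negιMap
  f21 := zeroMap C 2 2
  f3 := K.negιMap3
  leib1 x hx := by
    simp
  leib2 x hx := by
    obtain h0 | ⟨h0, h0', h0''⟩ := K.split (hx 0) <;>
    simp [*, lInfinity, leib]
    abel
  leib3 x hx := by
    obtain h0 | ⟨h0, h0', h0''⟩ := K.split (hx 0) <;>
    obtain h1 | ⟨h1, h1', h1''⟩ := K.split (hx 1) <;>
    simp [*, lInfinity, leib, koszulSign_three]
    rw [K.ι_lam_cyc (x 0).2]
    abel
  leib4 x hx := by
    obtain h0 | ⟨h0, h0', h0''⟩ := K.split (hx 0) <;>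
    obtain h1 | ⟨h1, h1', h1''⟩ := K.split (hx 1) <;>
    obtain h2 | ⟨h2, h2', h2''⟩ := K.split (hx 2) <;>
    simp [*, lInfinity, leib, koszulSign_four]
    generalize (x 0).2 = a, (x 1).2 = b, (x 2).2 = c, (x 3).2 = e
    have h := K.cartan_three a b c e
    -- All double contractions of `lam` on the four arguments equal, up to the sign of a
    -- permutation, the single function ω(v_a, v_b, v_c, v_e). They are brought to this form before
    -- comparing with `cartan_three`.
    have t₁ : K.ι a (K.ι e (K.lam b c)) = -K.ι e (K.ι c (K.lam a b)) := by
      rw [K.ι_ι a e, K.ι_lam_cyc a b c]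
    have t₂ : K.ι b (K.ι e (K.lam a c)) = K.ι e (K.ι c (K.lam a b)) := by
      rw [K.ι_ι b e, K.ι_lam b a c, map_neg, neg_neg, K.ι_lam_cyc a b c]
    have t₃ : K.ι c (K.ι e (K.lam a b)) = -K.ι e (K.ι c (K.lam a b)) := K.ι_ι c e _
    have t₄ : K.ι b (K.ι a (K.lam c e)) = K.ι e (K.ι c (K.lam a b)) := by
      rw [K.ι_lam_cyc a c e, t₂]
    have t₅ : K.ι c (K.ι a (K.lam b e)) = -K.ι e (K.ι c (K.lam a b)) := by
      rw [K.ι_lam_cyc a b e, t₃]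
    have t₆ : K.ι c (K.ι b (K.lam a e)) = K.ι e (K.ι c (K.lam a b)) := by
      rw [K.ι_lam b a e, map_neg, t₅, neg_neg]
    rw [K.ι_ι a b (K.lam c e), t₄] at h
    rw [t₁, t₂, t₃, t₄, t₅, t₆, K.lam_symm b a, K.lam_symm c a, K.lam_symm c b,
      K.ι_ι c b (K.lie a e), K.ι_ι c a (K.lie b e), K.ι_ι b a (K.lie c e)]
    simp only [map_neg, LinearMap.neg_apply]
    rw [K.ι_ι c (K.lam a b) e, K.ι_ι (K.lam b c) a e, eq_comm, ← sub_eq_zero,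
      ← sub_eq_zero.2 h]
    abel
  bd_f21 x hx := by
    obtain h0 | ⟨h0, h0', h0''⟩ := K.split (hx 0) <;>
    obtain h1 | ⟨h1, h1', h1''⟩ := K.split (hx 1) <;>
    simp [*, lInfinity, leib, koszulSign_two]
  sym_l211 x hx := by
    simp [*, lInfinity, leib]
  sym_l31 x hx := by
    obtain h0 | ⟨h0, h0', h0''⟩ := K.split (hx 0) <;>
    obtain h1 | ⟨h1, h1', h1''⟩ := K.split (hx 1) <;>
    simp [*, lInfinity, leib, koszulSign_three]
    rw [K.ι_ι (x 1).2]
    abel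
  sym_l32 x hx := by
    obtain h0 | ⟨h0, h0', h0''⟩ := K.split (hx 0) <;>
    obtain h1 | ⟨h1, h1', h1''⟩ := K.split (hx 1) <;>
    obtain h2 | ⟨h2, h2', h2''⟩ := K.split (hx 2) <;>
    simp [*, lInfinity, leib, koszulSign_three]

set_option maxHeartbeats 1000000 in
/-- The inverse of the comparison morphism. -/
def comparisonInv : WeakMorphism K.leib K.lInfinity where
  f1 := idMap C
  f2 := K.ιMap
  f21 := zeroMap C 2 2
  -- Forced by the vanishing of the third component of the composite. By antisymmetry of the double
  -- contraction it has the same values as the third component of `comparison`.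
  f3 := K.ιMap3
  leib1 x hx := by
    simp
  leib2 x hx := by
    obtain h0 | ⟨h0, h0', h0''⟩ := K.split (hx 0) <;>
    simp [*, lInfinity, leib]
    abel
  leib3 x hx := by
    obtain h0 | ⟨h0, h0', h0''⟩ := K.split (hx 0) <;>
    obtain h1 | ⟨h1, h1', h1''⟩ := K.split (hx 1) <;>
    simp [*, lInfinity, leib, koszulSign_three]
    rw [K.ι_lam_cyc (x 0).2]
    abel
  leib4 x hx := by
    obtain h0 | ⟨h0, h0', h0''⟩ := K.split (hx 0) <;>
    obtain h1 | ⟨h1, h1', h1''⟩ := K.split (hx 1) <;>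
    obtain h2 | ⟨h2, h2', h2''⟩ := K.split (hx 2) <;>
    simp [*, lInfinity, leib, koszulSign_four]
    generalize (x 0).2 = a, (x 1).2 = b, (x 2).2 = c, (x 3).2 = e
    have h := K.cartan_three a b c e
    rw [K.ι_ι a b (K.lam c e), K.ι_lam_cyc a c e, K.ι_ι b e, K.ι_lam b a c, map_neg, neg_neg,
      K.ι_lam_cyc a b c] at h
    rw [← neg_eq_iff_eq_neg] at h
    rw [← h]
    abel
  bd_f21 x hx := by
    obtain h0 | ⟨h0, h0', h0''⟩ := K.split (hx 0) <;>
    obtain h1 | ⟨h1, h1', h1''⟩ := K.split (hx 1) <;>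
    simp [*, lInfinity, leib, koszulSign_two]
  sym_l211 x hx := by
    simp [*, lInfinity, leib]
  sym_l31 x hx := by
    obtain h0 | ⟨h0, h0', h0''⟩ := K.split (hx 0) <;>
    obtain h1 | ⟨h1, h1', h1''⟩ := K.split (hx 1) <;>
    simp [*, lInfinity, leib, koszulSign_three]
    rw [K.ι_ι (x 0).2]
    abel
  sym_l32 x hx := by
    obtain h0 | ⟨h0, h0', h0''⟩ := K.split (hx 0) <;>
    obtain h1 | ⟨h1, h1', h1''⟩ := K.split (hx 1) <;>
    obtain h2 | ⟨h2, h2', h2''⟩ := K.split (hx 2) <;>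
    simp [*, lInfinity, leib, koszulSign_three]

/-- The second components are opposite. In the third, insertion into the first slot gives 0 because
a contraction has no Hamiltonian field, and the two insertions into the second slot cancel the sum
of the third components. -/
theorem comparison_isIso : K.comparison.IsIso := by
  refine ⟨K.comparisonInv, ⟨?_, ?_, ?_, ?_⟩, ⟨?_, ?_, ?_, ?_⟩⟩ <;> intro x hx
  · simp [*, comparison, comparisonInv]
  · obtain h0 | ⟨h0, h0', h0''⟩ := K.split (hx 0) <;>
    simp [*, comparison, comparisonInv]
  · simp [*, comparison, comparisonInv]
  · obtain h0 | ⟨h0, h0', h0''⟩ := K.split (hx 0) <;>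
    obtain h1 | ⟨h1, h1', h1''⟩ := K.split (hx 1) <;>
    simp [*, comparison, comparisonInv, koszulSign_three]
  · simp [*, comparison, comparisonInv]
  · obtain h0 | ⟨h0, h0', h0''⟩ := K.split (hx 0) <;>
    simp [*, comparison, comparisonInv]
  · simp [*, comparison, comparisonInv]
  · obtain h0 | ⟨h0, h0', h0''⟩ := K.split (hx 0) <;>
    obtain h1 | ⟨h1, h1', h1''⟩ := K.split (hx 1) <;>
    simp [*, comparison, comparisonInv, koszulSign_three]

end CartanCalculus

/-! ### Cartan's formulas on a normed space. -/

section LocalCalculus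

variable {E : Type*} [NormedAddCommGroup E] [NormedSpace ℝ E] {k : ℕ}

open ContinuousAlternatingMap

/-- The Lie derivative at `y` of a differential form on a normed space along a vector field. -/
def lieAt (V : E → E) (α : E → E [⋀^Fin k]→L[ℝ] ℝ) (y : E) (u : Fin k → E) : ℝ :=
  fderiv ℝ α y (V y) u + ∑ i, α y (Function.update u i (fderiv ℝ V y (u i)))

/-- The product rule, contraction being a continuous bilinear operation in the form and the vector.
-/
theorem fderiv_curryLeft_apply {V : E → E} {α : E → E [⋀^Fin (k + 1)]→L[ℝ] ℝ} {y : E}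
    (hV : DifferentiableAt ℝ V y) (hα : DifferentiableAt ℝ α y) (h : E) :
    fderiv ℝ (fun z => (α z).curryLeft (V z)) y h =
      (fderiv ℝ α y h).curryLeft (V y) + (α y).curryLeft (fderiv ℝ V y h) := by
  let L := (curryLeftLI (𝕜 := ℝ) (E := E) (F := ℝ) (n := k)).toContinuousLinearMap
  have h1 : HasFDerivAt (fun z => L (α z)) (L ∘L fderiv ℝ α y) y :=
    HasFDerivAt.comp (f := α) (g := L) y L.hasFDerivAt hα.hasFDerivAt
  have h2 := h1.clm_apply hV.hasFDerivAt
  have h3 := congrArg (fun T => T h) h2.fderiv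
  refine h3.trans ?_
  simp only [_root_.add_apply, ContinuousLinearMap.comp_apply,
    ContinuousLinearMap.flip_apply]
  exact add_comm _ _

/-- Cartan's formula for functions, whose contraction is zero; it is separate because contraction is
typed only on forms of degree k + 1. -/
theorem extDeriv_zero_form {α : E → E [⋀^Fin 0]→L[ℝ] ℝ} (V : E → E) (y : E) (u : Fin 0 → E) :
    (extDeriv α y).curryLeft (V y) u = lieAt V α y u := by
  rw [extDeriv, curryLeft_apply_apply, alternatizeUncurryFin_apply, lieAt]
  simp

/-- Cartan's formula. -/
theorem extDeriv_curryLeft_add {V : E → E} {α : E → E [⋀^Fin (k + 1)]→L[ℝ] ℝ} {y : E}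
    (hV : DifferentiableAt ℝ V y) (hα : DifferentiableAt ℝ α y) (u : Fin (k + 1) → E) :
    extDeriv (fun z => (α z).curryLeft (V z)) y u + (extDeriv α y).curryLeft (V y) u =
      lieAt V α y u := by
  rw [extDeriv, extDeriv, curryLeft_apply_apply, alternatizeUncurryFin_apply,
    alternatizeUncurryFin_apply, lieAt, Fin.sum_univ_succ (n := k + 1)]
  -- The product rule splits the i-th term of d ι_V α. In the part differentiating V, the sign is
  -- absorbed by moving the new vector from the front back to slot i.
  have h1 : ∀ i : Fin (k + 1), (-1 : ℤ) ^ (i : ℕ) •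
      fderiv ℝ (fun z => (α z).curryLeft (V z)) y (u i) (i.removeNth u) =
      (-1 : ℤ) ^ (i : ℕ) • fderiv ℝ α y (u i) (Matrix.vecCons (V y) (i.removeNth u)) +
      α y (Function.update u i (fderiv ℝ V y (u i))) := fun i => by
    rw [fderiv_curryLeft_apply hV hα, ContinuousAlternatingMap.add_apply, smul_add,
      curryLeft_apply_apply, curryLeft_apply_apply, ← map_insertNth, Fin.insertNth_removeNth,
      ← map_insertNth, Fin.insertNth_removeNth]
  have h2 : ∀ i : Fin (k + 1), i.succ.removeNth (Matrix.vecCons (V y) u : Fin (k + 2) → E) =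
      Matrix.vecCons (V y) (i.removeNth u) := fun i => by
    funext j
    refine Fin.cases ?_ (fun j => ?_) j
    · simp [Fin.removeNth]
    · simp [Fin.removeNth]
  -- In ι_V dα the leading V shifts every other index by one. The opposite sign makes these terms
  -- cancel the first parts in `h1`, and the term of index 0 is the derivative of α along V.
  have h3 : ∀ i : Fin (k + 1), (-1 : ℤ) ^ (i.succ : ℕ) •
      fderiv ℝ α y (Matrix.vecCons (V y) u i.succ)
        (i.succ.removeNth (Matrix.vecCons (V y) u : Fin (k + 2) → E)) =
      -((-1 : ℤ) ^ (i : ℕ) • fderiv ℝ α y (u i) (Matrix.vecCons (V y) (i.removeNth u))) :=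
    fun i => by
      rw [h2, Fin.val_succ, pow_succ, Matrix.cons_val_succ]
      simp
  simp_rw [h1, h3]
  rw [Finset.sum_add_distrib, Finset.sum_neg_distrib]
  simp
  ring

/-- The commutator of the Lie derivative and the contraction. -/
theorem lieAt_curryLeft {V W : E → E} {α : E → E [⋀^Fin (k + 1)]→L[ℝ] ℝ} {y : E}
    (hW : DifferentiableAt ℝ W y) (hα : DifferentiableAt ℝ α y) (u : Fin k → E) :
    lieAt V (fun z => (α z).curryLeft (W z)) y u =
      lieAt V α y (Matrix.vecCons (W y) u) +
        (α y).curryLeft (VectorField.lieBracket ℝ V W y) u := by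
  have h : ∀ i : Fin k, Function.update (Matrix.vecCons (W y) u : Fin (k + 1) → E) i.succ
      (fderiv ℝ V y (u i)) = Matrix.vecCons (W y) (Function.update u i (fderiv ℝ V y (u i))) :=
    fun i => (Fin.cons_update (α := fun _ => E) (W y) u i _).symm
  have h0 : Function.update (Matrix.vecCons (W y) u : Fin (k + 1) → E) 0 (fderiv ℝ V y (W y)) =
      Matrix.vecCons (fderiv ℝ V y (W y)) u := Fin.update_cons_zero (α := fun _ => E) _ _ _
  -- The derivative of W along V comes from the product rule, and the derivative of V along W is
  -- slot 0 of the sum for α. Their difference is the bracket.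
  rw [lieAt, lieAt, fderiv_curryLeft_apply hW hα, Fin.sum_univ_succ, VectorField.lieBracket]
  simp only [Matrix.cons_val_zero, Matrix.cons_val_succ, h, h0, map_sub,
    ContinuousAlternatingMap.add_apply, curryLeft_apply_apply, ContinuousAlternatingMap.sub_apply]
  ring

end LocalCalculus

/-! ### Transport of the formulas to the manifold. -/

section ManifoldCalculus
open scoped Manifold ContDiff
variable {E : Type u} [NormedAddCommGroup E] [NormedSpace ℝ E]
  {M : Type v} [TopologicalSpace M] [ChartedSpace E M] [IsManifold 𝓘(ℝ, E) ∞ M] {k : ℕ}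

theorem mfderiv_symm_mfderiv (a : M) {x : M} (hx : x ∈ (extChartAt 𝓘(ℝ, E) a).source)
    (v : TangentSpace 𝓘(ℝ, E) x) :
    mfderiv 𝓘(ℝ, E) 𝓘(ℝ, E) (extChartAt 𝓘(ℝ, E) a).symm (extChartAt 𝓘(ℝ, E) a x)
      (mfderiv 𝓘(ℝ, E) 𝓘(ℝ, E) (extChartAt 𝓘(ℝ, E) a) x v) = v := by
  have : IsManifold 𝓘(ℝ, E) 1 M := .of_le (n := ∞) (by simp)
  have h := mfderivWithin_extChartAt_symm_comp_mfderiv_extChartAt' (I := 𝓘(ℝ, E)) hx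
  rw [modelWithCornersSelf_coe, Set.range_id, mfderivWithin_univ] at h
  exact congrArg (fun T => T v) h

theorem localForm_contract (a : M) (v : ∀ x : M, TangentSpace 𝓘(ℝ, E) x)
    (α : PreForm E M (k + 1)) {y : E} (hy : y ∈ (extChartAt 𝓘(ℝ, E) a).target) :
    localForm a (contract v α) y = (localForm a α y).curryLeft (localField a v y) := by
  have h := mfderiv_symm_mfderiv a ((extChartAt 𝓘(ℝ, E) a).map_target hy)
    (v ((extChartAt 𝓘(ℝ, E) a).symm y))
  rw [(extChartAt 𝓘(ℝ, E) a).right_inv hy] at h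
  refine Eq.trans ?_ (ContinuousAlternatingMap.curryLeft_compContinuousLinearMap (E := E) (F := E)
    (α ((extChartAt 𝓘(ℝ, E) a).symm y))
    (mfderiv 𝓘(ℝ, E) 𝓘(ℝ, E) (extChartAt 𝓘(ℝ, E) a).symm y) (localField a v y)).symm
  exact congrArg (fun w : E =>
    ((α ((extChartAt 𝓘(ℝ, E) a).symm y)).curryLeft (E := E) w).compContinuousLinearMap
      (M := E) (M' := E) (mfderiv 𝓘(ℝ, E) 𝓘(ℝ, E) (extChartAt 𝓘(ℝ, E) a).symm y)) h.symm

/-- A form at x is recovered from its expression in the chart at x, since the derivative of the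
chart is inverted by that of its inverse. Pointwise identities of forms thereby become identities on
E. -/
theorem apply_eq_localForm (α : PreForm E M k) (x : M) (u : Fin k → TangentSpace 𝓘(ℝ, E) x) :
    α x u = localForm x α (extChartAt 𝓘(ℝ, E) x x)
      (fun i => mfderiv 𝓘(ℝ, E) 𝓘(ℝ, E) (extChartAt 𝓘(ℝ, E) x) x (u i)) := by
  let G : M → (Fin k → E) → ℝ := fun p w => α p w
  exact congrArg₂ G (extChartAt_to_inv (I := 𝓘(ℝ, E)) x).symm
    (funext fun i => (mfderiv_symm_mfderiv x (mem_extChartAt_source x) (u i)).symm)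

/-- Smoothness of a section is smoothness in a trivialization, and the tangent trivialization at `a`
acts on fibres as the derivative of the chart. -/
theorem localField_contDiffOn (a : M) (v : VectorField E M) :
    ContDiffOn ℝ ∞ (localField a v) (extChartAt 𝓘(ℝ, E) a).target := by
  have : IsManifold 𝓘(ℝ, E) 1 M := .of_le (n := ∞) (by simp)
  have h := ((trivializationAt E (TangentSpace 𝓘(ℝ, E) : M → Type _)
    a).contMDiffOn_section_baseSet_iff
    (IB := 𝓘(ℝ, E)) (n := ∞) (s := v)).1 v.contMDiff.contMDiffOn
  have h2 := h.comp (contMDiffOn_extChartAt_symm (n := ∞) (I := 𝓘(ℝ, E)) a) fun y hy => by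
    have := (extChartAt 𝓘(ℝ, E) a).map_target hy
    rw [extChartAt_source] at this
    simpa using this
  refine (contMDiffOn_iff_contDiffOn.1 h2).congr fun y hy => ?_
  have hs := (extChartAt 𝓘(ℝ, E) a).map_target hy
  rw [extChartAt_source] at hs
  have h3 := TangentBundle.continuousLinearMapAt_trivializationAt (𝕜 := ℝ) (I := 𝓘(ℝ, E)) hs
  have h4 := congrArg (fun T => T (v ((extChartAt 𝓘(ℝ, E) a).symm y))) h3
  refine h4.symm.trans ?_
  rw [Bundle.Trivialization.continuousLinearMapAt_apply,
    Bundle.Trivialization.linearMapAt_apply, if_pos (by simpa using hs)]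
  rfl

theorem localField_differentiableAt (a : M) (v : VectorField E M) {y : E}
    (hy : y ∈ (extChartAt 𝓘(ℝ, E) a).target) : DifferentiableAt ℝ (localField a v) y :=
  ((localField_contDiffOn a v).contDiffAt
    ((isOpen_extChartAt_target a).mem_nhds hy)).differentiableAt (by simp)

theorem IsSmooth.contract {α : PreForm E M (k + 1)} (hα : IsSmooth α) (v : VectorField E M) :
    IsSmooth (contract v α) := fun a => by
  let L : (E [⋀^Fin (k + 1)]→L[ℝ] ℝ) →L[ℝ] E →L[ℝ] E [⋀^Fin k]→L[ℝ] ℝ :=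
    (ContinuousAlternatingMap.curryLeftLI (𝕜 := ℝ) (E := E) (F := ℝ) (n := k)).toContinuousLinearMap
  have hL : ContDiff ℝ ∞ L := by exact ContinuousLinearMap.contDiff _
  have h := hL.comp_contDiffOn (hα a)
  exact (h.clm_apply (localField_contDiffOn a v)).congr fun _ hy => localForm_contract a v α hy

/-- The Lie bracket of smooth vector fields. -/
def bracket [FiniteDimensional ℝ E] (v w : VectorField E M) : VectorField E M :=
  haveI := FiniteDimensional.complete ℝ E
  -- The bracket costs one derivative, which is harmless as ∞ + 1 and ∞ agree definitionally.
  haveI : IsManifold 𝓘(ℝ, E) (∞ + 1) M := inferInstanceAs (IsManifold 𝓘(ℝ, E) ∞ M)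
  haveI : IsManifold 𝓘(ℝ, E) (minSmoothness ℝ 2) M := .of_le two_le
  ⟨VectorField.mlieBracket 𝓘(ℝ, E) v w, fun x =>
    ContMDiffAt.mlieBracket_vectorField (m := ⊤) (n := ⊤) (v.contMDiff x) (w.contMDiff x)
      (by rw [minSmoothness_of_isRCLikeNormedField]; exact le_rfl)⟩

theorem mpullbackWithin_eq_localField (a : M) (v : ∀ x : M, TangentSpace 𝓘(ℝ, E) x) {y : E}
    (hy : y ∈ (extChartAt 𝓘(ℝ, E) a).target) :
    VectorField.mpullbackWithin 𝓘(ℝ, E) 𝓘(ℝ, E) (extChartAt 𝓘(ℝ, E) a).symm v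
      (Set.range 𝓘(ℝ, E)) y = localField a v y := by
  have : IsManifold 𝓘(ℝ, E) 1 M := .of_le (n := ∞) (by simp)
  have h := ContinuousLinearMap.inverse_eq
    (mfderivWithin_extChartAt_symm_comp_mfderiv_extChartAt (I := 𝓘(ℝ, E)) hy)
    (mfderiv_extChartAt_comp_mfderivWithin_extChartAt_symm (I := 𝓘(ℝ, E)) hy)
  exact congrArg (fun T => T (v ((extChartAt 𝓘(ℝ, E) a).symm y))) h

/-- The manifold bracket is defined by pulling fields back along the inverse chart. Near the base
point these pullbacks agree with `localField`, and the bracket on E depends only on germs. -/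
theorem mfderiv_bracket [FiniteDimensional ℝ E] (v w : VectorField E M) (x : M) :
    mfderiv 𝓘(ℝ, E) 𝓘(ℝ, E) (extChartAt 𝓘(ℝ, E) x) x (bracket v w x) =
      VectorField.lieBracket ℝ (localField x v) (localField x w) (extChartAt 𝓘(ℝ, E) x x) := by
  have : IsManifold 𝓘(ℝ, E) 1 M := .of_le (n := ∞) (by simp)
  have hx := (isOpen_extChartAt_target (I := 𝓘(ℝ, E)) x).mem_nhds (mem_extChartAt_target x)
  let P : VectorField E M → E → E := fun v => VectorField.mpullbackWithin 𝓘(ℝ, E) 𝓘(ℝ, E)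
    (extChartAt 𝓘(ℝ, E) x).symm v (Set.range 𝓘(ℝ, E))
  have hev : ∀ v, P v =ᶠ[nhds (extChartAt 𝓘(ℝ, E) x x)] localField x v := fun v => by
    filter_upwards [hx] with y hy using mpullbackWithin_eq_localField x v hy
  have h := (hev v).lieBracket_vectorField_eq (𝕜 := ℝ) (hev w)
  obtain ⟨z, hz⟩ : ∃ z : E, VectorField.lieBracket ℝ (localField x v) (localField x w)
    (extChartAt 𝓘(ℝ, E) x x) = z := ⟨_, rfl⟩
  have hb : bracket v w x = (mfderiv 𝓘(ℝ, E) 𝓘(ℝ, E) (extChartAt 𝓘(ℝ, E) x) x).inverse z := by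
    rw [← hz, ← h, ← VectorField.lieBracketWithin_univ]
    refine (VectorField.mlieBracketWithin_apply (I := 𝓘(ℝ, E)) (s := Set.univ)).trans ?_
    simp only [P, modelWithCornersSelf_coe, Set.range_id, Set.preimage_univ, Set.inter_univ]
  rw [hb, hz]
  obtain ⟨e, he⟩ := isInvertible_mfderiv_extChartAt (I := 𝓘(ℝ, E)) (mem_extChartAt_source x)
  rw [← he, ContinuousLinearMap.inverse_equiv]
  exact e.apply_symm_apply _

theorem localForm_contract_eventuallyEq (x : M) (v : VectorField E M) (α : PreForm E M (k + 1)) :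
    localForm x (contract v α) =ᶠ[nhds (extChartAt 𝓘(ℝ, E) x x)]
      fun z => (localForm x α z).curryLeft (localField x v z) := by
  filter_upwards [(isOpen_extChartAt_target (I := 𝓘(ℝ, E)) x).mem_nhds (mem_extChartAt_target x)]
    with y hy using localForm_contract x v α hy

/-- Cartan's formula. -/
theorem extD_contract_add {α : PreForm E M (k + 1)} (hα : IsSmooth α) (v : VectorField E M) (x : M)
    (u : Fin (k + 1) → TangentSpace 𝓘(ℝ, E) x) :
    (extD (contract v α) + contract v (extD α)) x u = lieDeriv v α x u := by
  have hx := mem_extChartAt_target (I := 𝓘(ℝ, E)) x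
  rw [apply_eq_localForm, localForm_add, Pi.add_apply, localForm_extD (hα.contract v) x hx,
    localForm_contract x v _ hx, localForm_extD hα x hx,
    (localForm_contract_eventuallyEq x v α).extDeriv_eq]
  exact extDeriv_curryLeft_add (localField_differentiableAt x v hx)
    ((localForm_contDiffAt hα x hx).differentiableAt (by simp)) _

theorem contract_extD {α : PreForm E M 0} (hα : IsSmooth α) (v : VectorField E M) (x : M)
    (u : Fin 0 → TangentSpace 𝓘(ℝ, E) x) :
    contract v (extD α) x u = lieDeriv v α x u := by
  have hx := mem_extChartAt_target (I := 𝓘(ℝ, E)) x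
  rw [apply_eq_localForm, localForm_contract x v _ hx, localForm_extD hα x hx]
  exact extDeriv_zero_form _ _ _

theorem localField_apply (x : M) (v : ∀ x : M, TangentSpace 𝓘(ℝ, E) x) :
    localField x v (extChartAt 𝓘(ℝ, E) x x) =
      mfderiv 𝓘(ℝ, E) 𝓘(ℝ, E) (extChartAt 𝓘(ℝ, E) x) x (v x) := by
  let G : M → E := fun p => mfderiv 𝓘(ℝ, E) 𝓘(ℝ, E) (extChartAt 𝓘(ℝ, E) x) p (v p)
  exact congrArg G (extChartAt_to_inv (I := 𝓘(ℝ, E)) x)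

theorem lieAt_congr {V : E → E} {α β : E → E [⋀^Fin k]→L[ℝ] ℝ} {y : E} (h : α =ᶠ[nhds y] β)
    (u : Fin k → E) : lieAt V α y u = lieAt V β y u := by
  simp only [lieAt, h.fderiv_eq, h.eq_of_nhds]

theorem lieDeriv_contract [FiniteDimensional ℝ E] {α : PreForm E M (k + 1)} (hα : IsSmooth α)
    (v w : VectorField E M) (x : M) (u : Fin k → TangentSpace 𝓘(ℝ, E) x) :
    lieDeriv v (contract w α) x u =
      lieDeriv v α x (Matrix.vecCons (w x) u) + α x (Matrix.vecCons (bracket v w x) u) := by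
  have hx := mem_extChartAt_target (I := 𝓘(ℝ, E)) x
  let Φ : TangentSpace 𝓘(ℝ, E) x → E := mfderiv 𝓘(ℝ, E) 𝓘(ℝ, E) (extChartAt 𝓘(ℝ, E) x) x
  have hc : ∀ z : TangentSpace 𝓘(ℝ, E) x,
      (Matrix.vecCons (Φ z) (fun i => Φ (u i)) : Fin (k + 1) → E) =
      fun i => Φ ((Matrix.vecCons z u : Fin (k + 1) → TangentSpace 𝓘(ℝ, E) x) i) := fun z =>
    funext (Fin.cases rfl fun i => rfl)
  have h1 : lieDeriv v (contract w α) x u = _ :=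
    (lieAt_congr (localForm_contract_eventuallyEq x w α) _).trans
      (lieAt_curryLeft (localField_differentiableAt x w hx)
        ((localForm_contDiffAt hα x hx).differentiableAt (by simp)) (fun i => Φ (u i)))
  have h2 : (Matrix.vecCons (localField x w (extChartAt 𝓘(ℝ, E) x x)) (fun i => Φ (u i)) :
      Fin (k + 1) → E) = _ :=
    (congrArg (fun z : E => (Matrix.vecCons z (fun i => Φ (u i)) : Fin (k + 1) → E))
      (localField_apply x w)).trans (hc (w x))
  have h3 : (Matrix.vecCons (VectorField.lieBracket ℝ (localField x v) (localField x w)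
      (extChartAt 𝓘(ℝ, E) x x)) (fun i => Φ (u i)) : Fin (k + 1) → E) = _ :=
    (congrArg (fun z : E => (Matrix.vecCons z (fun i => Φ (u i)) : Fin (k + 1) → E))
      (mfderiv_bracket v w x).symm).trans (hc (bracket v w x))
  exact h1.trans (congrArg₂ (fun s t => s + t)
    (congrArg (lieAt (localField x v) (localForm x α) (extChartAt 𝓘(ℝ, E) x x)) h2)
    ((congrArg (localForm x α (extChartAt 𝓘(ℝ, E) x x)) h3).trans
      (apply_eq_localForm α x _).symm))

theorem contract_contract (v w : ∀ x : M, TangentSpace 𝓘(ℝ, E) x) (α : PreForm E M (k + 2)) :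
    contract v (contract w α) = -contract w (contract v α) := by
  funext x
  refine ContinuousAlternatingMap.ext fun u => ?_
  have h := (α x).map_swap (Matrix.vecCons (v x) (Matrix.vecCons (w x) u))
    (i := 0) (j := 1) (by simp)
  refine Eq.trans (congrArg (α x) (funext fun i => ?_)) h
  refine Fin.cases ?_ (fun i => Fin.cases ?_ (fun i => ?_) i) i
  · rfl
  · rfl
  · rw [Function.comp_apply, Equiv.swap_apply_of_ne_of_ne (Fin.succ_ne_zero _)
      (by simp [Fin.ext_iff])]
    rfl

/-- The Lie derivative along a vector field of a form of positive degree, through Cartan's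
formula. -/
def lieForm (v : ∀ x : M, TangentSpace 𝓘(ℝ, E) x) (α : PreForm E M (k + 1)) :
    PreForm E M (k + 1) :=
  extD (contract v α) + contract v (extD α)

/-- Cartan's formula turns both sides into Lie derivatives, where the commutator rule is a chart
computation. -/
theorem lieForm_contract [FiniteDimensional ℝ E] {α : PreForm E M (k + 2)} (hα : IsSmooth α)
    (v w : VectorField E M) :
    lieForm v (contract w α) = contract w (lieForm v α) + contract (bracket v w) α := by
  funext x
  refine ContinuousAlternatingMap.ext fun u => ?_
  rw [lieForm, extD_contract_add (hα.contract w), lieDeriv_contract hα, ← extD_contract_add hα]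
  rfl

/-- The case where the contracted form is a function, so that the Lie derivative on the left has a
single term. -/
theorem contract_extD_contract [FiniteDimensional ℝ E] {α : PreForm E M 1} (hα : IsSmooth α)
    (v w : VectorField E M) :
    contract v (extD (contract w α)) = contract w (lieForm v α) + contract (bracket v w) α := by
  funext x
  refine ContinuousAlternatingMap.ext fun u => ?_
  rw [contract_extD (hα.contract w), lieDeriv_contract hα, ← extD_contract_add hα]
  rfl

end ManifoldCalculus

/-! ### Hamiltonian fields and the Cartan calculus of a 3-plectic form. -/

section Plectic
open scoped Manifold ContDiff
open plecticComplex
variable {E : Type u} [NormedAddCommGroup E] [NormedSpace ℝ E]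
  {M : Type v} [TopologicalSpace M] [ChartedSpace E M] [IsManifold 𝓘(ℝ, E) ∞ M] {k m : ℕ}

/-- The contraction of smooth forms with smooth vector fields. -/
def Form.contract : VectorField E M →ₗ[ℝ] Form E M (k + 1) →ₗ[ℝ] Form E M k :=
  LinearMap.mk₂ ℝ (fun v α => ⟨ThreePlectic.contract v α.1, IsSmooth.contract α.2 v⟩)
    (fun v w α => Subtype.ext (funext fun x =>
      map_add (ContinuousAlternatingMap.curryLeft (E := E) (α.1 x)) (v x) (w x)))
    (fun c v α => Subtype.ext (funext fun x =>
      map_smul (ContinuousAlternatingMap.curryLeft (E := E) (α.1 x)) c (v x)))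
    (fun _ _ _ => rfl) (fun _ _ _ => rfl)

theorem Form.contract_contract (v w : VectorField E M) (α : Form E M (k + 2)) :
    contract v (contract w α) = -contract w (contract v α) :=
  Subtype.ext (ThreePlectic.contract_contract v w α.1)

theorem Form.deRham_contract_contract [FiniteDimensional ℝ E] (v w : VectorField E M)
    (α : Form E M (k + 2)) :
    deRham k (contract v (contract w α)) + contract v (deRham (k + 1) (contract w α)) =
      contract w (deRham (k + 1) (contract v α) + contract v (deRham (k + 2) α)) +
        contract (bracket v w) α :=
  Subtype.ext (lieForm_contract α.2 v w)

theorem Form.contract_deRham_contract [FiniteDimensional ℝ E] (v w : VectorField E M)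
    (α : Form E M 1) :
    contract v (deRham 0 (contract w α)) =
      contract w (deRham 0 (contract v α) + contract v (deRham 1 α)) + contract (bracket v w) α :=
  Subtype.ext (contract_extD_contract α.2 v w)

theorem isHamiltonianField_iff {ϖ : Form E M (m + 2)} {α : Form E M m} {v : VectorField E M} :
    IsHamiltonianField ϖ α v ↔ deRham m α = -Form.contract v ϖ :=
  ⟨fun h => Subtype.ext h, fun h => congrArg Subtype.val h⟩

theorem IsPlectic.field_unique {ϖ : Form E M (m + 2)} (hϖ : IsPlectic (m + 1) ϖ)
    {α : Form E M m} {v w : VectorField E M} (hv : IsHamiltonianField ϖ α v)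
    (hw : IsHamiltonianField ϖ α w) : v = w := by
  ext x
  have h := congrFun (neg_injective (hv.symm.trans hw)) x
  refine sub_eq_zero.1 (hϖ.nondegenerate x (v x - w x) ?_)
  exact (map_sub (ContinuousAlternatingMap.curryLeft (E := E) (ϖ.1 x)) (v x) (w x)).trans
    (sub_eq_zero.2 h)

theorem isHamiltonianField_hamiltonianField {ϖ : Form E M (m + 2)} {α : Form E M m}
    (hα : ∃ v, IsHamiltonianField ϖ α v) : IsHamiltonianField ϖ α (hamiltonianField ϖ α) := by
  rw [hamiltonianField, dif_pos hα]
  exact hα.choose_spec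

theorem IsPlectic.hamiltonianField_eq {ϖ : Form E M (m + 2)} (hϖ : IsPlectic (m + 1) ϖ)
    {α : Form E M m} {v : VectorField E M} (hv : IsHamiltonianField ϖ α v) :
    hamiltonianField ϖ α = v :=
  hϖ.field_unique (isHamiltonianField_hamiltonianField ⟨v, hv⟩) hv

theorem IsHamiltonianField.deRham_contract {ϖ : Form E M (m + 2)} {α : Form E M m}
    {v : VectorField E M} (hv : IsHamiltonianField ϖ α v) :
    deRham (m + 1) (Form.contract v ϖ) = 0 := by
  rw [← neg_neg (Form.contract v ϖ), ← isHamiltonianField_iff.1 hv, map_neg, deRham_deRham,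
    neg_zero]

/-- The contraction of a plectic form with two Hamiltonian vector fields is Hamiltonian, and its
vector field is the Lie bracket. -/
theorem IsPlectic.isHamiltonianField_bracket [FiniteDimensional ℝ E] {ϖ : Form E M (m + 3)}
    (hϖ : IsPlectic (m + 2) ϖ) {α β : Form E M (m + 1)} {v w : VectorField E M}
    (hv : IsHamiltonianField ϖ α v) (hw : IsHamiltonianField ϖ β w) :
    IsHamiltonianField ϖ (Form.contract w (Form.contract v ϖ)) (bracket v w) := by
  rw [isHamiltonianField_iff, Form.contract_contract, map_neg]
  -- In the commutator rule applied to ω every term but two vanishes, since ω, ι_v ω and ι_w ω are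
  -- closed. What is left is d ι_v ι_w ω = ι_[v,w] ω.
  have h := Form.deRham_contract_contract v w ϖ
  rw [hv.deRham_contract, hw.deRham_contract, hϖ.closed] at h
  simpa using h

namespace plecticComplex

variable {ϖ : Form E M 4}

/-- The component of degree `1`, as a smooth 1-form. -/
def oneForm (a : (plecticComplex ϖ).Tot) : Form E M 1 := a.2.1

/-- The component of degree `2`, as a smooth function. -/
def zeroForm (a : (plecticComplex ϖ).Tot) : Form E M 0 := a.2.2

theorem ext {a b : (plecticComplex ϖ).Tot} (h0 : hamForm a = hamForm b)
    (h1 : oneForm a = oneForm b) (h2 : zeroForm a = zeroForm b) : a = b :=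
  Prod.ext (Subtype.ext h0) (Prod.ext h1 h2)

@[simp]
theorem hamForm_add (a b : (plecticComplex ϖ).Tot) : hamForm (a + b) = hamForm a + hamForm b := rfl

@[simp]
theorem oneForm_add (a b : (plecticComplex ϖ).Tot) : oneForm (a + b) = oneForm a + oneForm b := rfl

@[simp]
theorem zeroForm_add (a b : (plecticComplex ϖ).Tot) :
    zeroForm (a + b) = zeroForm a + zeroForm b := rfl

@[simp]
theorem hamForm_neg (a : (plecticComplex ϖ).Tot) : hamForm (-a) = -hamForm a := rfl

@[simp]
theorem oneForm_neg (a : (plecticComplex ϖ).Tot) : oneForm (-a) = -oneForm a := rfl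

@[simp]
theorem zeroForm_neg (a : (plecticComplex ϖ).Tot) : zeroForm (-a) = -zeroForm a := rfl

@[simp]
theorem hamForm_zero : hamForm (0 : (plecticComplex ϖ).Tot) = 0 := rfl

@[simp]
theorem oneForm_zero : oneForm (0 : (plecticComplex ϖ).Tot) = 0 := rfl

@[simp]
theorem zeroForm_zero : zeroForm (0 : (plecticComplex ϖ).Tot) = 0 := rfl

@[simp]
theorem hamForm_d (a : (plecticComplex ϖ).Tot) :
    hamForm ((plecticComplex ϖ).d a) = deRham 1 (oneForm a) := rfl

@[simp]
theorem oneForm_d (a : (plecticComplex ϖ).Tot) :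
    oneForm ((plecticComplex ϖ).d a) = deRham 0 (zeroForm a) := rfl

@[simp]
theorem zeroForm_d (a : (plecticComplex ϖ).Tot) : zeroForm ((plecticComplex ϖ).d a) = 0 := rfl

theorem isHamiltonianField_hamForm (a : (plecticComplex ϖ).Tot) :
    IsHamiltonianField (m := 2) ϖ (hamForm a) (hamiltonianField (m := 2) ϖ (hamForm a)) :=
  isHamiltonianField_hamiltonianField (Subtype.property (show hamiltonianForms (m := 2) ϖ from a.1))

theorem deRham_hamForm (a : (plecticComplex ϖ).Tot) :
    deRham 2 (hamForm a) = -Form.contract (hamiltonianField (m := 2) ϖ (hamForm a)) ϖ :=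
  isHamiltonianField_iff.1 (isHamiltonianField_hamForm a)

/-- The Hamiltonian vector field of an element of the complex. -/
def fieldMap (hϖ : IsPlectic 3 ϖ) : (plecticComplex ϖ).Tot →ₗ[ℝ] VectorField E M where
  toFun a := hamiltonianField (m := 2) ϖ (hamForm a)
  -- Linearity is uniqueness: the sum of the two fields satisfies the equation defining the field of
  -- the sum.
  map_add' a b := hϖ.hamiltonianField_eq (m := 2) <| isHamiltonianField_iff.2 <| by
    change deRham 2 (hamForm a + hamForm b) = _
    rw [map_add, deRham_hamForm, deRham_hamForm, map_add, LinearMap.add_apply]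
    exact (neg_add _ _).symm
  map_smul' c a := hϖ.hamiltonianField_eq (m := 2) <| isHamiltonianField_iff.2 <| by
    change deRham 2 (c • hamForm a) = _
    rw [map_smul, deRham_hamForm, map_smul, LinearMap.smul_apply]
    exact smul_neg _ _

variable (hϖ : IsPlectic 3 ϖ)

theorem deRham_hamForm' (a : (plecticComplex ϖ).Tot) :
    deRham 2 (hamForm a) = -Form.contract (fieldMap hϖ a) ϖ := deRham_hamForm a

theorem fieldMap_eq {a : (plecticComplex ϖ).Tot} {v : VectorField E M}
    (h : deRham 2 (hamForm a) = -Form.contract v ϖ) : fieldMap hϖ a = v :=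
  hϖ.hamiltonianField_eq (m := 2) (isHamiltonianField_iff.2 h)

theorem fieldMap_eq_zero {a : (plecticComplex ϖ).Tot} (h : deRham 2 (hamForm a) = 0) :
    fieldMap hϖ a = 0 :=
  fieldMap_eq hϖ (by rw [h, map_zero]; exact neg_zero.symm)

theorem deRham_contract_fieldMap (a : (plecticComplex ϖ).Tot) :
    deRham 3 (Form.contract (fieldMap hϖ a) ϖ) = 0 :=
  (isHamiltonianField_hamForm a).deRham_contract

theorem deRham_contract_contract_fieldMap [FiniteDimensional ℝ E] (a b : (plecticComplex ϖ).Tot) :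
    deRham 2 (Form.contract (fieldMap hϖ b) (Form.contract (fieldMap hϖ a) ϖ)) =
      -Form.contract (bracket (fieldMap hϖ a) (fieldMap hϖ b)) ϖ :=
  isHamiltonianField_iff.1 (hϖ.isHamiltonianField_bracket (m := 1) (isHamiltonianField_hamForm a)
    (isHamiltonianField_hamForm b))

/-- The contraction of an element with the Hamiltonian vector field of another one. -/
def contraction :
    (plecticComplex ϖ).Tot →ₗ[ℝ] (plecticComplex ϖ).Tot →ₗ[ℝ] (plecticComplex ϖ).Tot :=
  LinearMap.mk₂ ℝ (fun a b => ((0 : hamiltonianForms (m := 2) ϖ),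
      Form.contract (fieldMap hϖ a) (hamForm b), Form.contract (fieldMap hϖ a) (oneForm b)))
    (fun a b c => ext (add_zero _).symm
      ((Form.contract ∘ₗ fieldMap hϖ).map_add₂ a b (hamForm c))
      ((Form.contract ∘ₗ fieldMap hϖ).map_add₂ a b (oneForm c)))
    (fun c a b => ext (smul_zero c).symm
      ((Form.contract ∘ₗ fieldMap hϖ).map_smul₂ c a (hamForm b))
      ((Form.contract ∘ₗ fieldMap hϖ).map_smul₂ c a (oneForm b)))
    (fun a _ _ => ext (add_zero _).symm ((Form.contract (fieldMap hϖ a)).map_add _ _)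
      ((Form.contract (fieldMap hϖ a)).map_add _ _))
    (fun c a b => ext (smul_zero c).symm ((Form.contract (fieldMap hϖ a)).map_smul c (hamForm b))
      ((Form.contract (fieldMap hϖ a)).map_smul c (oneForm b)))

theorem contract_contract_mem [FiniteDimensional ℝ E] (a b : (plecticComplex ϖ).Tot) :
    Form.contract (fieldMap hϖ b) (Form.contract (fieldMap hϖ a) ϖ) ∈
      hamiltonianForms (m := 2) ϖ :=
  ⟨_, isHamiltonianField_iff.2 (deRham_contract_contract_fieldMap hϖ a b)⟩

/-- The contraction of the plectic form with the Hamiltonian vector fields of two elements. -/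
def hamiltonianBracket [FiniteDimensional ℝ E] :
    (plecticComplex ϖ).Tot →ₗ[ℝ] (plecticComplex ϖ).Tot →ₗ[ℝ] (plecticComplex ϖ).Tot :=
  LinearMap.mk₂ ℝ (fun a b => ((⟨_, contract_contract_mem hϖ a b⟩ : hamiltonianForms (m := 2) ϖ),
      (0 : Form E M 1), (0 : Form E M 0)))
    (fun a b c => ext
      ((congrArg _ ((Form.contract ∘ₗ fieldMap hϖ).map_add₂ a b ϖ)).trans
        ((Form.contract (fieldMap hϖ c)).map_add _ _)) (add_zero _).symm (add_zero _).symm)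
    (fun c a b => ext
      ((congrArg _ ((Form.contract ∘ₗ fieldMap hϖ).map_smul₂ c a ϖ)).trans
        ((Form.contract (fieldMap hϖ b)).map_smul c _)) (smul_zero c).symm (smul_zero c).symm)
    (fun _ b c => ext ((Form.contract ∘ₗ fieldMap hϖ).map_add₂ b c _)
      (add_zero _).symm (add_zero _).symm)
    (fun c _ b => ext ((Form.contract ∘ₗ fieldMap hϖ).map_smul₂ c b _)
      (smul_zero c).symm (smul_zero c).symm)

@[simp]
theorem hamForm_contraction (a b : (plecticComplex ϖ).Tot) :
    hamForm (contraction hϖ a b) = 0 := rfl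

@[simp]
theorem oneForm_contraction (a b : (plecticComplex ϖ).Tot) :
    oneForm (contraction hϖ a b) = Form.contract (fieldMap hϖ a) (hamForm b) := rfl

@[simp]
theorem zeroForm_contraction (a b : (plecticComplex ϖ).Tot) :
    zeroForm (contraction hϖ a b) = Form.contract (fieldMap hϖ a) (oneForm b) := rfl

theorem fieldMap_d (a : (plecticComplex ϖ).Tot) : fieldMap hϖ ((plecticComplex ϖ).d a) = 0 :=
  fieldMap_eq_zero hϖ (deRham_deRham (oneForm a))

theorem fieldMap_of_fst {a : (plecticComplex ϖ).Tot} (h : a.1 = 0) : fieldMap hϖ a = 0 :=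
  fieldMap_eq_zero hϖ (by
    have : hamForm a = 0 := congrArg Subtype.val h
    rw [this, map_zero])

theorem contraction_eq_zero {a : (plecticComplex ϖ).Tot} (h : fieldMap hϖ a = 0) :
    contraction hϖ a = 0 :=
  LinearMap.ext fun b => ext rfl (by simp [h]) (by simp [h])

variable [FiniteDimensional ℝ E]

@[simp]
theorem hamForm_hamiltonianBracket (a b : (plecticComplex ϖ).Tot) :
    hamForm (hamiltonianBracket hϖ a b) =
      Form.contract (fieldMap hϖ b) (Form.contract (fieldMap hϖ a) ϖ) := rfl

@[simp]
theorem oneForm_hamiltonianBracket (a b : (plecticComplex ϖ).Tot) :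
    oneForm (hamiltonianBracket hϖ a b) = 0 := rfl

@[simp]
theorem zeroForm_hamiltonianBracket (a b : (plecticComplex ϖ).Tot) :
    zeroForm (hamiltonianBracket hϖ a b) = 0 := rfl

/-- This lets `lam a b` stand for the bracket of fields, so that the abstract calculus never
mentions vector fields. -/
theorem fieldMap_hamiltonianBracket (a b : (plecticComplex ϖ).Tot) :
    fieldMap hϖ (hamiltonianBracket hϖ a b) = bracket (fieldMap hϖ a) (fieldMap hϖ b) :=
  fieldMap_eq hϖ (deRham_contract_contract_fieldMap hϖ a b)

theorem hamiltonianBracket_eq_zero {a : (plecticComplex ϖ).Tot} (h : fieldMap hϖ a = 0) :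
    hamiltonianBracket hϖ a = 0 :=
  LinearMap.ext fun b => ext (by simp [h]) rfl rfl

/-- The Cartan calculus of a 3-plectic manifold. -/
def cartanCalculus : CartanCalculus (plecticComplex ϖ) where
  ι := contraction hϖ
  lam := hamiltonianBracket hϖ
  ι_mem := by
    rintro a b q ⟨h0, h1, -⟩
    refine ⟨fun _ => rfl, fun h => ?_, fun h => ?_⟩
    · have : hamForm b = 0 := congrArg Subtype.val (h0 (by omega))
      change Form.contract (fieldMap hϖ a) (hamForm b) = 0
      rw [this, map_zero]
    · have : oneForm b = 0 := h1 (by omega)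
      change Form.contract (fieldMap hϖ a) (oneForm b) = 0
      rw [this, map_zero]
  lam_mem a b := ⟨fun h => absurd rfl h, fun _ => rfl, fun _ => rfl⟩
  ι_eq_zero a h := contraction_eq_zero hϖ (fieldMap_of_fst hϖ h)
  lam_eq_zero a h := hamiltonianBracket_eq_zero hϖ (fieldMap_of_fst hϖ h)
  ι_d a := contraction_eq_zero hϖ (fieldMap_d hϖ a)
  lam_d a := hamiltonianBracket_eq_zero hϖ (fieldMap_d hϖ a)
  ι_fst a b := rfl
  ι_ι a b c := ext (by simp) (by simp) (by simpa using Form.contract_contract _ _ _)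
  ι_ι_ι a b c e := ext (by simp) (by simp) (by simp)
  lam_symm a b := ext (by simpa using Form.contract_contract _ _ _) (by simp) (by simp)
  ι_lam a b c := ext (by simp) (by
    simp only [oneForm_contraction, oneForm_neg, hamForm_hamiltonianBracket]
    rw [Form.contract_contract (fieldMap hϖ a), Form.contract_contract (fieldMap hϖ a),
      Form.contract_contract (fieldMap hϖ b) (fieldMap hϖ c), map_neg, neg_neg]) (by simp)
  lie_ι a b c := by
    refine ext (by simp) ?_ ?_
    · have h := Form.deRham_contract_contract (fieldMap hϖ a) (fieldMap hϖ b) (hamForm c)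
      rw [deRham_hamForm' hϖ c, map_neg, Form.contract_contract (fieldMap hϖ a) (fieldMap hϖ c),
        neg_neg, map_add] at h
      simpa [fieldMap_hamiltonianBracket] using h
    · have h := Form.contract_deRham_contract (fieldMap hϖ a) (fieldMap hϖ b) (oneForm c)
      rw [map_add] at h
      simpa [fieldMap_hamiltonianBracket] using h
  lie_lam a b c := by
    refine ext ?_ (by simp) (by simp)
    -- The commutator rule for v_a and v_c on the closed form ι(v_b)ω; the differentials of double
    -- contractions of ω become contractions with brackets.
    have h := Form.deRham_contract_contract (fieldMap hϖ a) (fieldMap hϖ c)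
      (Form.contract (fieldMap hϖ b) ϖ)
    rw [Form.contract_contract (fieldMap hϖ a) (fieldMap hϖ b) ϖ, map_neg,
      deRham_contract_contract_fieldMap, deRham_contract_contract_fieldMap,
      deRham_contract_fieldMap, map_zero, add_zero, neg_neg, map_neg,
      ← Form.contract_contract (bracket _ _)] at h
    simpa [fieldMap_hamiltonianBracket] using h

end plecticComplex

end Plectic

/-! ### Identification with the prescribed structure maps. -/

section Structures
open scoped Manifold ContDiff
open plecticComplex
variable {E : Type u} [NormedAddCommGroup E] [NormedSpace ℝ E] [FiniteDimensional ℝ E]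
  {M : Type v} [TopologicalSpace M] [ChartedSpace E M] [IsManifold 𝓘(ℝ, E) ∞ M]
  {ϖ : Form E M 4} (hϖ : IsPlectic 3 ϖ)

theorem isLInfinity_lInfinity : IsLInfinity ϖ (cartanCalculus hϖ).lInfinity where
  l2 _ _ := ⟨rfl, rfl, rfl⟩
  l3 _ _ _ := ⟨neg_zero (G := PreForm E M 2), rfl, neg_zero (G := PreForm E M 0)⟩
  l4 _ _ _ _ := ⟨neg_zero (G := PreForm E M 2), neg_zero (G := PreForm E M 1), rfl⟩
  l21 := rfl
  l211 := rfl
  l31 := rfl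
  l32 := rfl

/-- The `lam` summand is exactly ι(v_a)db for the Hamiltonian 2-form b, so the abstract Lie
derivative satisfies the untruncated Cartan formula. -/
theorem hamForm_lie (a b : (plecticComplex ϖ).Tot) :
    hamForm ((cartanCalculus hϖ).lie a b) =
      deRham 1 (Form.contract (fieldMap hϖ a) (hamForm b)) +
        Form.contract (fieldMap hϖ a) (deRham 2 (hamForm b)) := by
  rw [deRham_hamForm' hϖ b, map_neg, ← Form.contract_contract]
  exact congrArg (fun α => α + _) (add_zero _)

theorem oneForm_lie (a b : (plecticComplex ϖ).Tot) :
    oneForm ((cartanCalculus hϖ).lie a b) =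
      deRham 0 (Form.contract (fieldMap hϖ a) (oneForm b)) +
        Form.contract (fieldMap hϖ a) (deRham 1 (oneForm b)) :=
  add_zero _

theorem zeroForm_lie (a b : (plecticComplex ϖ).Tot) :
    zeroForm ((cartanCalculus hϖ).lie a b) =
      Form.contract (fieldMap hϖ a) (deRham 0 (zeroForm b)) :=
  (add_zero _).trans (zero_add _)

theorem isLeib_leib : IsLeib ϖ (cartanCalculus hϖ).leib where
  l2 a b := by
    refine ⟨fun x u => ?_, fun x u => ?_, fun x u => ?_⟩
    · exact (congrArg (fun α : Form E M 2 => α.1 x u) (hamForm_lie hϖ a b)).trans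
        (extD_contract_add (hamForm b).2 (fieldMap hϖ a) x u)
    · exact (congrArg (fun α : Form E M 1 => α.1 x u) (oneForm_lie hϖ a b)).trans
        (extD_contract_add (oneForm b).2 (fieldMap hϖ a) x u)
    · exact (congrArg (fun α : Form E M 0 => α.1 x u) (zeroForm_lie hϖ a b)).trans
        (contract_extD (zeroForm b).2 (fieldMap hϖ a) x u)
  l21 _ _ := ⟨add_zero (M := PreForm E M 2) 0, rfl, rfl⟩
  l211 := rfl
  l3 := rfl
  l31 := rfl
  l32 := rfl
  l4 := rfl

theorem isComparison_comparison : IsComparison (cartanCalculus hϖ).comparison where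
  f1 _ := rfl
  f2 _ _ := ⟨neg_zero (G := PreForm E M 2), rfl, rfl⟩
  f21 := rfl
  -- The degree 1 component is -ι(v_b) of the 2-form component of the inner contraction, which is 0.
  f3 _ b _ := ⟨neg_zero (G := PreForm E M 2), congrArg Subtype.val (a₂ := (0 : Form E M 1))
    (by rw [← neg_zero, ← (Form.contract (fieldMap hϖ b)).map_zero]; rfl), rfl⟩

end Structures

end ThreePlectic

end

open scoped Manifold ContDiff in
theorem mainTheorem6 {E : Type*} [NormedAddCommGroup E] [NormedSpace ℝ E] [FiniteDimensional ℝ E]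
    {M : Type*} [TopologicalSpace M] [ChartedSpace E M] [IsManifold 𝓘(ℝ, E) ∞ M]
    (ϖ : ThreePlectic.Form E M 4) (hϖ : ThreePlectic.IsPlectic 3 ϖ) :
    ∃ (A B : ThreePlectic.WeakLie3Algebra (ThreePlectic.plecticComplex ϖ))
      (f : ThreePlectic.WeakMorphism A B),
      ThreePlectic.IsLInfinity ϖ A ∧ ThreePlectic.IsLeib ϖ B ∧
        ThreePlectic.IsComparison f ∧ f.IsIso :=
  ⟨_, _, (ThreePlectic.plecticComplex.cartanCalculus hϖ).comparison,
    ThreePlectic.isLInfinity_lInfinity hϖ, ThreePlectic.isLeib_leib hϖ,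
    ThreePlectic.isComparison_comparison hϖ,
    (ThreePlectic.plecticComplex.cartanCalculus hϖ).comparison_isIso⟩
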